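/- A \emph{schema} $\mathbf{T}$ is a finite set of relation symbols with arities; its arity is the maximum arity of its symbols. A \emph{database} over $\mathbf{T}$ is a finite set of atoms over $\mathbf{T}$ whose terms are constants. A CQ over $\mathbf{T}$ is a formula $q(\bar x)=\exists\bar y\,\varphi(\bar x,\bar y)$, with $\varphi$ a finite conjunction of atoms over $\mathbf{T}$ whose terms are variables, and $\bar x$ the tuple of its (distinct) free variables, called answer variables. A UCQ is a finite non-empty disjunction of CQs with the same answer variables. $q(D)$ denotes the set of answers to $q$ over $D$. The \emph{treewidth} of a graph is the minimum width (maximal bag size minus one) of its tree decompositions if it has an edge, and is $1$ otherwise. For $k\ge 1$, $\mathsf{CQ}_k$ is the class of CQs $\exists\bar y\,\varphi(\bar x,\bar y)$ such that the subgraph of the Gaifman graph of $\varphi$ induced by the existentially quantified variables $\bar y$ has treewidth at most $k$, and $\mathsf{UCQ}_k$ is the class of UCQs all of whose disjuncts are in $\mathsf{CQ}_k$. A \emph{TGD} is a sentence $\forall\bar x\forall\bar y(\varphi(\bar x,\bar y)\to\exists\bar z\,\psi(\bar x,\bar z))$ with $\varphi$ a finite, possibly empty, and $\psi$ a finite non-empty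 conjunction of constant-free atoms, where $\bar x$ consists of the variables occurring in both $\varphi$ and $\psi$. It is \emph{frontier-guarded} if $\varphi$ is empty or has an atom containing all variables of $\bar x$. $\mathsf{FG}_m$ is the class of finite sets of frontier-guarded TGDs with at most $m$ head atoms each. A \emph{constraint-query specification} (CQS) over $\mathbf{T}$ is a pair $S=(\Sigma,q)$ of a finite set $\Sigma$ of TGDs over $\mathbf{T}$ and a UCQ $q$ over $\mathbf{T}$; it is from $(\mathsf{FG}_m,\mathsf{UCQ})$ if $\Sigma\in\mathsf{FG}_m$. Two CQSs $S=(\Sigma,q)$ and $S'=(\Sigma,q')$ with the same $\Sigma$ are \emph{equivalent}, $S\equiv S'$, if $q(D)=q'(D)$ for every database $D$ over $\mathbf{T}$ with $D\models\Sigma$. $S=(\Sigma,q)$ is \emph{uniformly $\mathsf{UCQ}_k$-equivalent} if $S\equiv(\Sigma,q')$ for some $q'\in\mathsf{UCQ}_k$ over $\mathbf{T}$. A \emph{contraction} of a CQ is a CQ obtained from it by identifying variables, where an answer variable identified with non-answer variables remains that answer variable, and two distinct answer variables must not be identified. For $S=(\Sigma,q)$ let $S_k^a=(\Sigma,q_k^a)$,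 where $q_k^a$ is the UCQ consisting of all contractions of disjuncts of $q$ that belong to $\mathsf{CQ}_k$. \textbf{Proposition.} Let $r,m\ge 1$ and $k\ge 1$ with $k\ge r\cdot m-1$. Let $S$ be a CQS from $(\mathsf{FG}_m,\mathsf{UCQ})$ over a schema of arity $r$. The following are equivalent: (1) $S$ is uniformly $\mathsf{UCQ}_k$-equivalent; (2) $S\equiv S_k^a$. -/

import Mathlib

namespace CQSpec

/-- Variables: a countably infinite set. -/
abbrev Var : Type := ℕ

/-- Constants: a countably infinite set (kept apart from the variables by typing). -/
abbrev Const : Type := ℕ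

/-! ### Schemas, atoms, instances -/

/-- A relational schema: a finite set of relation symbols with associated arities. -/
structure Schema where
  Rel : Type
  finite : Finite Rel
  ar : Rel → ℕ

/-- `T.HasArity r`: the number `r` is the maximum of the arities of the symbols of `T`. -/
def Schema.HasArity (T : Schema) (r : ℕ) : Prop :=
  IsGreatest (Set.range T.ar) r

/-- An atom `R(t₁, …, tₗ)` over the schema `T` with terms from `α`. -/
@[ext]
structure Atom (T : Schema) (α : Type) where
  rel : T.Rel
  args : Fin (T.ar rel) → α

/-- Apply a function to all terms of an atom. -/
def Atom.map {T : Schema} {α β : Type} (f : α → β) (a : Atom T α) : Atom T β where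
  rel := a.rel
  args := fun i => f (a.args i)

/-- The set of terms of an atom. -/
def Atom.terms {T : Schema} {α : Type} (a : Atom T α) : Set α := Set.range a.args

/-- The set of terms mentioned in a set of atoms (the active domain). -/
def adom {T : Schema} {α : Type} (A : Set (Atom T α)) : Set α := ⋃ a ∈ A, a.terms

/-- An instance is a possibly infinite set of atoms over constants; it is a *database* if it is
finite. -/
abbrev Inst (T : Schema) : Type := Set (Atom T Const)

/-- `h` is a homomorphism from the set of atoms `A` to the set of atoms `B`.
(Only the values of `h` on `adom A` matter.) -/
def IsHom {T : Schema} {α β : Type} (h : α → β) (A : Set (Atom T α)) (B : Set (Atom T β)) :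
    Prop :=
  ∀ a ∈ A, a.map h ∈ B

/-! ### Treewidth -/

/-- A tree decomposition of a graph. -/
structure TreeDecomposition {V : Type} (G : SimpleGraph V) where
  Node : Type
  tree : SimpleGraph Node
  isTree : tree.IsTree
  bag : Node → Set V
  cover : ∀ v, ∃ t, v ∈ bag t
  edge : ∀ u v, G.Adj u v → ∃ t, u ∈ bag t ∧ v ∈ bag t
  connected : ∀ v, (tree.induce {t | v ∈ bag t}).Connected

/-- The width of a decomposition is the maximal size of a bag minus one; here: it is at most `k`. -/
def TreeDecomposition.WidthLE {V : Type} {G : SimpleGraph V} (δ : TreeDecomposition G) (k : ℕ) :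
    Prop :=
  ∀ t, (δ.bag t).encard ≤ (k : ℕ∞) + 1

/-- The treewidth of `G` is at most `k`, where the treewidth is the minimum width of a tree
decomposition if `G` has an edge, and is one if `G` has no edge. -/
def TreewidthLE {V : Type} (G : SimpleGraph V) (k : ℕ) : Prop :=
  (G = ⊥ ∧ 1 ≤ k) ∨ (G ≠ ⊥ ∧ ∃ δ : TreeDecomposition G, δ.WidthLE k)

/-- Distinct terms are adjacent iff some atom of `A` mentions both. Restricted to `adom A` this is
the Gaifman graph of `A`; terms outside `adom A` are isolated. -/
def gaifman {T : Schema} {α : Type} (A : Set (Atom T α)) : SimpleGraph α where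
  Adj u v := u ≠ v ∧ ∃ a ∈ A, u ∈ a.terms ∧ v ∈ a.terms
  symm := ⟨fun _ _ h => ⟨h.1.symm, h.2.imp fun _ ha => ⟨ha.1, ha.2.2, ha.2.1⟩⟩⟩
  loopless := ⟨fun _ h => h.1 rfl⟩

/-! ### Conjunctive queries and unions of conjunctive queries -/

/-- A conjunctive query `∃ ȳ (R₁(x̄₁) ∧ … ∧ Rₗ(x̄ₗ))` of arity `n`: the tuple `ans` lists the free
variables, which are distinct and occur in atoms; all other variables are existentially
quantified. -/
@[ext]
structure CQ (T : Schema) (n : ℕ) where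
  ans : Fin n → Var
  atoms : Set (Atom T Var)
  finite : atoms.Finite
  injective : Function.Injective ans
  occurs : ∀ i, ans i ∈ adom atoms

/-- The set of answers to `q` over an instance. -/
def CQ.eval {T : Schema} {n : ℕ} (q : CQ T n) (I : Inst T) : Set (Fin n → Const) :=
  {c | ∃ h : Var → Const, IsHom h q.atoms I ∧ ∀ i, h (q.ans i) = c i}

/-- The existentially quantified variables of a CQ. -/
def CQ.exVars {T : Schema} {n : ℕ} (q : CQ T n) : Set Var := adom q.atoms \ Set.range q.ans

/-- The class `CQ_k`: the subgraph of the Gaifman graph induced by the existentially quantified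
variables has treewidth at most `k`. -/
def CQ.InCQk {T : Schema} {n : ℕ} (q : CQ T n) (k : ℕ) : Prop :=
  TreewidthLE ((gaifman q.atoms).induce q.exVars) k

/-- A union of conjunctive queries: a finite non-empty disjunction of CQs with the same answer
variables. -/
structure UCQ (T : Schema) (n : ℕ) where
  ans : Fin n → Var
  disjuncts : Set (CQ T n)
  finite : disjuncts.Finite
  nonempty : disjuncts.Nonempty
  ans_eq : ∀ p ∈ disjuncts, p.ans = ans

/-- The set of answers to a UCQ over an instance. -/
def UCQ.eval {T : Schema} {n : ℕ} (q : UCQ T n) (I : Inst T) : Set (Fin n → Const) :=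
  ⋃ p ∈ q.disjuncts, p.eval I

/-- The class `UCQ_k`. -/
def UCQ.InUCQk {T : Schema} {n : ℕ} (q : UCQ T n) (k : ℕ) : Prop :=
  ∀ p ∈ q.disjuncts, p.InCQk k

/-! ### Tuple-generating dependencies -/

/-- A TGD `φ(x̄,ȳ) → ∃ z̄ ψ(x̄,z̄)`, where the body `φ` may be empty and the head `ψ` is
non-empty. -/
structure TGD (T : Schema) where
  body : Set (Atom T Var)
  head : Set (Atom T Var)
  body_finite : body.Finite
  head_finite : head.Finite
  head_nonempty : head.Nonempty

/-- The frontier: the variables that appear in both body and head. -/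
def TGD.frontier {T : Schema} (σ : TGD T) : Set Var := adom σ.body ∩ adom σ.head

/-- `I ⊨ σ`. -/
def TGD.Sat {T : Schema} (I : Inst T) (σ : TGD T) : Prop :=
  ∀ h : Var → Const, IsHom h σ.body I →
    ∃ h' : Var → Const, Set.EqOn h' h σ.frontier ∧ IsHom h' σ.head I

/-- Frontier-guardedness: the body is empty or some body atom contains all frontier variables. -/
def TGD.FrontierGuarded {T : Schema} (σ : TGD T) : Prop :=
  σ.body = ∅ ∨ ∃ α ∈ σ.body, σ.frontier ⊆ α.terms

/-- The class `FG_m` of sets of frontier-guarded TGDs with at most `m` head atoms. -/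
def InFG {T : Schema} (m : ℕ) (C : Set (TGD T)) : Prop :=
  ∀ σ ∈ C, σ.FrontierGuarded ∧ σ.head.ncard ≤ m

/-! ### Constraint-query specifications -/

/-- A constraint-query specification over `T`: a finite set of TGDs (the integrity constraints)
and a UCQ. -/
structure CQS (T : Schema) (n : ℕ) where
  constraints : Set (TGD T)
  constraints_finite : constraints.Finite
  query : UCQ T n

/-- Containment of CQSs with the same integrity constraints: `q(D) ⊆ q'(D)` for every database `D`
that satisfies the constraints. -/
def CQS.Contained {T : Schema} {n : ℕ} (S S' : CQS T n) : Prop :=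
  S.constraints = S'.constraints ∧
    ∀ D : Inst T, D.Finite → (∀ σ ∈ S.constraints, σ.Sat D) → S.query.eval D ⊆ S'.query.eval D

/-- Equivalence of CQSs. -/
def CQS.Equivalent {T : Schema} {n : ℕ} (S S' : CQS T n) : Prop :=
  S.Contained S' ∧ S'.Contained S

/-- Uniform `UCQ_k`-equivalence: some CQS with the same integrity constraints (hence from the same
class of TGDs) and a query from `UCQ_k` is equivalent to `S`. -/
def CQS.UniformlyUCQkEquivalent {T : Schema} {n : ℕ} (S : CQS T n) (k : ℕ) : Prop :=
  ∃ S' : CQS T n, S'.constraints = S.constraints ∧ S'.query.InUCQk k ∧ S.Equivalent S'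

/-! ### Contractions and the `UCQ_k`-approximation -/

/-- `p` is a contraction of `q`: it arises from `q` by identifying variables. The map `f` sends
every variable of `q` to the representative of its class, a variable of that class; answer
variables represent themselves, so an answer variable absorbs the existential variables identified
with it, and distinct answer variables are never identified. -/
def CQ.IsContraction {T : Schema} {n : ℕ} (q p : CQ T n) : Prop :=
  ∃ f : Var → Var,
    (∀ v ∈ adom q.atoms, f v ∈ adom q.atoms ∧ f (f v) = f v) ∧
    (∀ i, f (q.ans i) = q.ans i) ∧
    p.ans = q.ans ∧ p.atoms = Atom.map f '' q.atoms

theorem mem_adom {T : Schema} {α : Type} {A : Set (Atom T α)} {v : α} :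
    v ∈ adom A ↔ ∃ a ∈ A, ∃ i, a.args i = v := by
  simp [adom, Atom.terms]

theorem adom_finite {T : Schema} {α : Type} {A : Set (Atom T α)} (hA : A.Finite) :
    (adom A).Finite :=
  hA.biUnion fun a _ => Set.finite_range a.args

theorem adom_image {T : Schema} {α β : Type} (f : α → β) (A : Set (Atom T α)) :
    adom (Atom.map f '' A) = f '' adom A := by
  ext v
  simp only [mem_adom, Set.mem_image]
  constructor
  · rintro ⟨_, ⟨a, ha, rfl⟩, i, rfl⟩
    exact ⟨a.args i, ⟨a, ha, i, rfl⟩, rfl⟩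
  · rintro ⟨_, ⟨a, ha, i, rfl⟩, rfl⟩
    exact ⟨a.map f, ⟨a, ha, rfl⟩, i, rfl⟩

/-- There are finitely many atoms with terms from a finite set. -/
theorem finite_atoms {T : Schema} {α : Type} {X : Set α} (hX : X.Finite) :
    {a : Atom T α | ∀ i, a.args i ∈ X}.Finite := by
  have := T.finite
  have : Finite X := hX
  refine (Set.finite_range
    (fun s : (R : T.Rel) × (Fin (T.ar R) → X) => (⟨s.1, fun i => (s.2 i : α)⟩ : Atom T α))).subset ?_
  intro a ha
  exact ⟨⟨a.rel, fun i => ⟨a.args i, ha i⟩⟩, rfl⟩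

theorem finite_contractions {T : Schema} {n : ℕ} (q : CQ T n) : {p | q.IsContraction p}.Finite := by
  have hX := adom_finite q.finite
  refine Set.Finite.of_finite_image (f := CQ.atoms)
    ((finite_atoms hX).finite_subsets.subset ?_) ?_
  · rintro _ ⟨p, ⟨f, hf, -, -, hp⟩, rfl⟩ b hb i
    rw [hp] at hb
    obtain ⟨a, ha, rfl⟩ := hb
    exact (hf _ (mem_adom.2 ⟨a, ha, i, rfl⟩)).1
  · rintro p ⟨_, _, _, hp, _⟩ p' ⟨_, _, _, hp', _⟩ h
    exact CQ.ext (hp.trans hp'.symm) h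

/-- Identifying all existential variables with each other yields a contraction in `CQ_k`. -/
theorem exists_contraction {T : Schema} {n k : ℕ} (hk : 1 ≤ k) (q : CQ T n) :
    ∃ p, q.IsContraction p ∧ p.InCQk k := by
  classical
  obtain ⟨f, hf, hfa, hfe⟩ : ∃ f : Var → Var,
      (∀ v ∈ adom q.atoms, f v ∈ adom q.atoms ∧ f (f v) = f v) ∧
      (∀ i, f (q.ans i) = q.ans i) ∧
      (∀ u ∈ adom q.atoms, ∀ v ∈ adom q.atoms,
        f u ∉ Set.range q.ans → f v ∉ Set.range q.ans → f u = f v) := by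
    by_cases h : q.exVars.Nonempty
    · obtain ⟨y, hy⟩ := h
      refine ⟨fun v => if v ∈ Set.range q.ans then v else y, ?_, ?_, ?_⟩
      · intro v hv
        by_cases hr : v ∈ Set.range q.ans
        · simp only [if_pos hr]
          exact ⟨hv, trivial⟩
        · simp only [if_neg hr, if_neg hy.2]
          exact ⟨hy.1, trivial⟩
      · intro i
        exact if_pos ⟨i, rfl⟩
      · intro u _ v _ hu hv
        by_cases h1 : u ∈ Set.range q.ans
        · simp only [if_pos h1] at hu
          exact absurd h1 hu
        by_cases h2 : v ∈ Set.range q.ans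
        · simp only [if_pos h2] at hv
          exact absurd h2 hv
        simp only [if_neg h1, if_neg h2]
    · refine ⟨id, fun v hv => ⟨hv, rfl⟩, fun _ => rfl, ?_⟩
      intro u hu v _ hu' _
      exact absurd ⟨u, hu, hu'⟩ h
  let p : CQ T n :=
    { ans := q.ans
      atoms := Atom.map f '' q.atoms
      finite := q.finite.image _
      injective := q.injective
      occurs := fun i => by
        rw [adom_image]
        exact ⟨q.ans i, q.occurs i, hfa i⟩ }
  refine ⟨p, ⟨f, hf, hfa, rfl, rfl⟩, Or.inl ⟨?_, hk⟩⟩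
  ext ⟨u, hu, hu'⟩ ⟨v, hv, hv'⟩
  simp only [SimpleGraph.bot_adj, iff_false]
  intro hadj
  apply hadj.1
  change u ∈ adom (Atom.map f '' q.atoms) at hu
  change v ∈ adom (Atom.map f '' q.atoms) at hv
  rw [adom_image] at hu hv
  obtain ⟨u₁, hu₁, rfl⟩ := hu
  obtain ⟨v₁, hv₁, rfl⟩ := hv
  exact hfe u₁ hu₁ v₁ hv₁ hu' hv'

/-- The `UCQ_k`-approximation of a UCQ: the disjunction of all contractions of its disjuncts that
belong to `CQ_k`. -/
def UCQ.approx {T : Schema} {n : ℕ} (q : UCQ T n) (k : ℕ) (hk : 1 ≤ k) : UCQ T n where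
  ans := q.ans
  disjuncts := {p | (∃ p₀ ∈ q.disjuncts, p₀.IsContraction p) ∧ p.InCQk k}
  finite := (q.finite.biUnion fun p₀ _ => finite_contractions p₀).subset fun p hp => by
    obtain ⟨⟨p₀, h₀, h⟩, -⟩ := hp
    exact Set.mem_biUnion h₀ h
  nonempty := by
    obtain ⟨p₀, h₀⟩ := q.nonempty
    obtain ⟨p, hp, hpk⟩ := exists_contraction hk p₀
    exact ⟨p, ⟨p₀, h₀, hp⟩, hpk⟩
  ans_eq := by
    rintro p ⟨⟨p₀, h₀, _, _, _, hp, _⟩, -⟩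
    rw [hp, q.ans_eq p₀ h₀]

/-- The `UCQ_k`-approximation `S_k^a` of a CQS `S`. -/
def CQS.approx {T : Schema} {n : ℕ} (S : CQS T n) (k : ℕ) (hk : 1 ≤ k) : CQS T n where
  constraints := S.constraints
  constraints_finite := S.constraints_finite
  query := S.query.approx k hk

end CQSpec

namespace CQSpec

/-! Contractions only shrink a query, so the point is that every answer to `S` over a model `D` is
an answer to the approximation. Let a disjunct `p` in `CQ_k` of the equivalent query witness the
answer by a homomorphism to `D`. Chase `p`, but let `D` dictate the steps: each new bag copies a
head together with a match of that head in `D`. The chase then maps back to `D` (`isHom_proj`). As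
the frontier of a new bag is empty or lies in one atom of the parent bag, a decomposition of `p`
without its answer variables extends to the chase by bags of at most `r * m ≤ k + 1` terms
(`exists_decomposition`). If a disjunct of `q` maps to the chase with its answer tuple on that of
`p`, it factors through a contraction that embeds into the chase. This contraction inherits width
`k`, and projecting to `D` yields the answer.

That `q` does map to the chase has to come from finite databases, while the chase may be infinite.
Hence terms are identified when they agree up to a fixed depth, including colours that separate a
null from its near subterms (`exists_finite_image`). The finite quotient still maps to `D` and
satisfies the constraints (`sat_image`), so `q` has a match there. Matches of small queries lift
back (`exists_lift`): unwinding the finitely many bags involved succeeds because the colours exclude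
short cycles among their nulls (`no_short_cycle`). -/

/-! ### Terms of the Skolem chase and their bounded codes -/

/-- Terms of a Skolem chase: elements of the root bag, and nulls `null l z t` created at position `z`
of a bag with label `l` above the tuple `t`. -/
inductive Tm (X Λ : Type) : Type where
  | root (x : X) : Tm X Λ
  | null (l : Λ) (z : X) (t : X → Tm X Λ) : Tm X Λ

/-- `Sub n s u`: the term `u` is a subterm of `s` at depth `n`. -/
inductive Sub {X Λ : Type} : ℕ → Tm X Λ → Tm X Λ → Prop
  | zero (s) : Sub 0 s s
  | succ {n l z t u} (x : X) : Sub n (t x) u → Sub (n + 1) (Tm.null l z t) u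

theorem exists_fresh (S : Finset ℕ) : ∃ c, c ≤ S.card ∧ c ∉ S := by
  obtain ⟨c, hc, hS⟩ := Finset.exists_mem_notMem_of_card_lt_card
    (s := S) (t := Finset.range (S.card + 1)) (by simp)
  exact ⟨c, by simpa [Nat.lt_succ_iff] using hc, hS⟩

/-- A number outside a finite set, at most its cardinality. -/
noncomputable def fresh (S : Finset ℕ) : ℕ := (exists_fresh S).choose

theorem fresh_le (S : Finset ℕ) : fresh S ≤ S.card := (exists_fresh S).choose_spec.1
theorem fresh_notMem (S : Finset ℕ) : fresh S ∉ S := (exists_fresh S).choose_spec.2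

/-- The colours of the nulls at depth `n` in a term, for the greedy colouring in which a null avoids
the colours of its proper subterms of depth at most `N`. -/
noncomputable def layer {X Λ : Type} [Fintype X] (N : ℕ) : Tm X Λ → ℕ → Finset ℕ
  | .root _, _ => ∅
  | .null _ _ t, 0 =>
      {fresh (Finset.univ.biUnion fun x => (Finset.range N).biUnion fun n => layer N (t x) n)}
  | .null _ _ t, n + 1 => Finset.univ.biUnion fun x => layer N (t x) n

theorem card_layer_le {X Λ : Type} [Fintype X] (N : ℕ) (s : Tm X Λ) (n : ℕ) :
    (layer N s n).card ≤ Fintype.card X ^ n := by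
  induction n generalizing s with
  | zero => cases s <;> simp [layer]
  | succ n ih =>
    cases s with
    | root x => simp [layer]
    | null l z t =>
      rw [layer, pow_succ']
      exact Finset.card_biUnion_le_card_mul _ _ _ fun x _ => ih (t x)

/-- A colouring of nulls (by their tuples) is `N`-proper if the colour of a null differs from the
colours of its proper subterms of depth at most `N`. -/
def Proper {X Λ K : Type} (N : ℕ) (cl : (X → Tm X Λ) → K) : Prop :=
  ∀ t x n l z u, n < N → Sub n (t x) (Tm.null l z u) → cl t ≠ cl u

/-- A term has boundedly many subterms up to depth `N`, with a bound independent of the term, so the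
greedy colouring needs only a finite palette. Finiteness of the set of codes rests on this. -/
theorem exists_proper (X Λ : Type) [Finite X] (N : ℕ) :
    ∃ (c : ℕ) (cl : (X → Tm X Λ) → Fin c), Proper N cl := by
  have := Fintype.ofFinite X
  let S : (X → Tm X Λ) → Finset ℕ := fun t =>
    Finset.univ.biUnion fun x => (Finset.range N).biUnion fun n => layer N (t x) n
  have hS : ∀ t, (S t).card ≤ Fintype.card X * ∑ n ∈ Finset.range N, Fintype.card X ^ n := by
    intro t
    refine Finset.card_biUnion_le_card_mul _ _ _ fun x _ => ?_
    exact Finset.card_biUnion_le.trans (Finset.sum_le_sum fun n _ => card_layer_le N _ n)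
  refine ⟨_, fun t => ⟨fresh (S t), Nat.lt_succ_of_le ((fresh_le _).trans (hS t))⟩, ?_⟩
  intro t x n l z u hn hsub heq
  have key : ∀ (n : ℕ) (s : Tm X Λ), Sub n s (Tm.null l z u) → fresh (S u) ∈ layer N s n := by
    intro n s h
    generalize hw : Tm.null l z u = w at h
    induction h with
    | zero s => subst hw; simp [layer, S]
    | succ x _ ih =>
      rw [layer]
      exact Finset.mem_biUnion.2 ⟨x, Finset.mem_univ _, ih hw⟩
  have h1 := key n _ hsub
  have h2 : fresh (S t) = fresh (S u) := by simpa using heq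
  apply fresh_notMem (S t)
  rw [h2]
  exact Finset.mem_biUnion.2 ⟨x, Finset.mem_univ _,
    Finset.mem_biUnion.2 ⟨n, Finset.mem_range.2 hn, h1⟩⟩

/-- Codes of terms: their truncations at a given depth. -/
def Code (X Λ K : Type) : ℕ → Type
  | 0 => X ⊕ K
  | L + 1 => X ⊕ (K × Λ × X × (X → Code X Λ K L))

theorem finite_code (X Λ K : Type) [Finite X] [Finite Λ] [Finite K] (L : ℕ) :
    Finite (Code X Λ K L) := by
  induction L with
  | zero => exact inferInstanceAs (Finite (X ⊕ K))
  | succ L ih => exact inferInstanceAs (Finite (X ⊕ (K × Λ × X × (X → Code X Λ K L))))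

section code
variable {X Λ K : Type} (cl : (X → Tm X Λ) → K)

/-- Truncation of a term at depth `L`, where nulls are decorated with their colours. -/
def code : (L : ℕ) → Tm X Λ → Code X Λ K L
  | 0, .root x => Sum.inl x
  | 0, .null _ _ t => Sum.inr (cl t)
  | _ + 1, .root x => Sum.inl x
  | L + 1, .null l z t => Sum.inr (cl t, l, z, fun x => code L (t x))

variable {cl}

/-- Roots share their code with no other term, at any depth. This keeps answer tuples in place when
matches are lifted. -/
theorem code_root_left {L : ℕ} {x : X} {s : Tm X Λ}
    (h : code cl L (Tm.root x) = code cl L s) : s = Tm.root x := by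
  cases L <;> cases s <;> simp only [code] at h
  all_goals first
    | cases h; rfl
    | cases h

/-- At positive depth a code shows label and position, and one level of precision is lost on the
arguments; at depth zero only the colour remains. -/
theorem code_null_succ {L : ℕ} {l l' : Λ} {z z' : X} {t t' : X → Tm X Λ} :
    code cl (L + 1) (Tm.null l z t) = code cl (L + 1) (Tm.null l' z' t') ↔
      cl t = cl t' ∧ l = l' ∧ z = z' ∧ ∀ x, code cl L (t x) = code cl L (t' x) := by
  constructor
  · intro h
    simp only [code] at h
    have := Sum.inr.inj h
    simp only [Prod.mk.injEq] at this
    exact ⟨this.1, this.2.1, this.2.2.1, fun x => congrFun this.2.2.2 x⟩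
  · rintro ⟨h, rfl, rfl, h'⟩
    simp only [code, h, funext h']
    rfl

theorem code_mono {L : ℕ} {s s' : Tm X Λ} (h : code cl (L + 1) s = code cl (L + 1) s') :
    code cl L s = code cl L s' := by
  induction L generalizing s s' with
  | zero =>
    cases s with
    | root x => rw [code_root_left h]
    | null l z t =>
      cases s' with
      | root x => cases code_root_left h.symm
      | null l' z' t' => exact congrArg Sum.inr (code_null_succ.1 h).1
  | succ L ih =>
    cases s with
    | root x => rw [code_root_left h]
    | null l z t =>
      cases s' with
      | root x => cases code_root_left h.symm
      | null l' z' t' =>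
        have := code_null_succ.1 h
        exact code_null_succ.2 ⟨this.1, this.2.1, this.2.2.1, fun x => ih (this.2.2.2 x)⟩

theorem code_of_le {L L' : ℕ} (hL : L ≤ L') {s s' : Tm X Λ}
    (h : code cl L' s = code cl L' s') : code cl L s = code cl L s' := by
  induction hL with
  | refl => exact h
  | step _ ih => exact ih (code_mono h)

/-- Terms with equal codes have subterms with equal codes. -/
theorem Sub.transfer {n L : ℕ} (hn : n ≤ L) {s s' u : Tm X Λ} (hu : Sub n s u)
    (h : code cl L s = code cl L s') :
    ∃ u', Sub n s' u' ∧ code cl (L - n) u = code cl (L - n) u' := by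
  induction hu generalizing L s' with
  | zero s => exact ⟨s', Sub.zero _, h⟩
  | @succ n l z t u x hx ih =>
    obtain ⟨L, rfl⟩ : ∃ L', L = L' + 1 := ⟨L - 1, by omega⟩
    cases s' with
    | root y => cases code_root_left h.symm
    | null l' z' t' =>
      obtain ⟨u', hu', h'⟩ := ih (by omega) ((code_null_succ.1 h).2.2.2 x)
      exact ⟨u', Sub.succ x hu', by rwa [Nat.add_sub_add_right]⟩

/-- There is no short cycle of nulls each of which has, up to codes, the preceding one among its
arguments. -/
theorem no_short_cycle {N L : ℕ} (hcl : Proper N cl) {J : Type} [Finite J] [Nonempty J]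
    (hN : Nat.card J ≤ N) (hL : Nat.card J ≤ L) (f : J → J) (l : J → Λ) (z x : J → X)
    (t : J → X → Tm X Λ)
    (h : ∀ j, code cl L (Tm.null (l j) (z j) (t j)) = code cl L (t (f j) (x j))) : False := by
  -- Each application of `f` moves the copy of null `j` one level deeper into a term and costs one
  -- level of precision.
  have chain : ∀ n ≤ L + 1, ∀ j, ∃ s,
      Sub n (Tm.null (l (f^[n] j)) (z (f^[n] j)) (t (f^[n] j))) s ∧
      code cl (L + 1 - n) (Tm.null (l j) (z j) (t j)) = code cl (L + 1 - n) s := by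
    intro n
    induction n with
    | zero => exact fun _ j => ⟨_, Sub.zero _, rfl⟩
    | succ n ih =>
      intro hn j
      obtain ⟨s, hs, hc⟩ := ih (by omega) j
      obtain ⟨u, hu, hc'⟩ := hs.transfer (by omega) (h (f^[n] j))
      rw [Function.iterate_succ_apply']
      refine ⟨u, Sub.succ _ hu, ?_⟩
      rw [Nat.add_sub_add_right, ← hc']
      exact code_of_le (by omega) hc
  obtain ⟨j₀⟩ := ‹Nonempty J›
  have := Fintype.ofFinite J
  -- Pigeonhole yields a null that recurs, up to codes, as its own proper subterm at depth at most
  -- `Nat.card J`. Depth zero of the code still shows the colour, against properness.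
  obtain ⟨a, b, hab, he⟩ := Fintype.exists_ne_map_eq_of_card_lt
    (fun a : Fin (Fintype.card J + 1) => f^[a] j₀) (by simp)
  wlog hlt : a < b generalizing a b
  · exact this b a hab.symm he.symm (lt_of_le_of_ne (not_lt.1 hlt) hab.symm)
  have hlt' : (a : ℕ) < b := hlt
  have hb : (b : ℕ) ≤ Nat.card J := by rw [Nat.card_eq_fintype_card]; omega
  set j := f^[a] j₀ with hj
  obtain ⟨n, hn⟩ : ∃ n, (b : ℕ) = n + 1 + a := ⟨b - a - 1, by omega⟩
  have hper : f^[n + 1] j = j := by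
    rw [hj, ← Function.iterate_add_apply, ← hn]
    exact he.symm
  obtain ⟨s, hs, hc⟩ := chain (n + 1) (by omega) j
  rw [hper] at hs
  cases s with
  | root y => cases code_root_left hc.symm
  | null l' z' u =>
    have h0 := code_of_le (Nat.zero_le _) hc
    simp only [code] at h0
    cases hs with
    | succ y hy => exact hcl _ _ _ _ _ _ (by omega) hy (Sum.inr.inj h0)

end code

/-! ### Bags of the chase -/

section bags
variable {X Λ : Type} (Fr : Λ → Set X) (Adm : Option Λ → (X → X) → Λ → Prop)

open Classical in
/-- The bag with label `l` above the tuple `t`: frontier positions take their values from `t`, the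
other ones hold new nulls. -/
noncomputable def bagStep (l : Λ) (t : X → Tm X Λ) : X → Tm X Λ :=
  fun v => if v ∈ Fr l then t v else Tm.null l v t

variable {Fr} in
theorem bagStep_mem {l : Λ} {v : X} (h : v ∈ Fr l) (t : X → Tm X Λ) :
    bagStep Fr l t v = t v := if_pos h

variable {Fr} in
theorem bagStep_notMem {l : Λ} {v : X} (h : v ∉ Fr l) (t : X → Tm X Λ) :
    bagStep Fr l t v = Tm.null l v t := if_neg h

/-- The bags of the chase tree, with the heights of their derivations. The relation `Adm l e l'`
says that below a bag with label `l`, one with label `l'` is attached along `e`. -/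
inductive IsBag : ℕ → Option Λ → (X → Tm X Λ) → Prop
  | root : IsBag 0 none Tm.root
  | step {n l b e l'} : IsBag n l b → Adm l e l' → IsBag (n + 1) (some l') (bagStep Fr l' (b ∘ e))

variable {Fr Adm}

theorem IsBag.eq_root {n : ℕ} {b : X → Tm X Λ} (h : IsBag Fr Adm n none b) : b = Tm.root := by
  cases h; rfl

theorem IsBag.exists_parent {n : ℕ} {l' : Λ} {b : X → Tm X Λ} (h : IsBag Fr Adm n (some l') b) :
    ∃ n' l b' e, n = n' + 1 ∧ IsBag Fr Adm n' l b' ∧ Adm l e l' ∧ b = bagStep Fr l' (b' ∘ e) := by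
  cases h with
  | step h1 h2 => exact ⟨_, _, _, _, rfl, h1, h2, rfl⟩

/-- Short families of bags lift: equalities of codes become equalities of terms in a suitable
family of bags with the same labels. -/
theorem exists_lift {K : Type} {cl : (X → Tm X Λ) → K} {N : ℕ} (hcl : Proper N cl)
    {I : Type} [DecidableEq I] (w : ℕ) :
    ∀ (A : Finset I) (L : ℕ) (h : I → ℕ) (l : I → Option Λ) (b : I → X → Tm X Λ),
      A.card + ∑ i ∈ A, h i ≤ w → A.card ≤ L → A.card ≤ N →
      (∀ i ∈ A, IsBag Fr Adm (h i) (l i) (b i)) →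
      ∃ b' : I → X → Tm X Λ, (∀ i ∈ A, ∃ n, IsBag Fr Adm n (l i) (b' i)) ∧
        ∀ i ∈ A, ∀ i' ∈ A, ∀ x x', code cl L (b i x) = code cl L (b i' x') →
          b' i x = b' i' x' := by
  -- The measure counts bags plus heights: each case below drops a bag or replaces one by its lower
  -- parent.
  induction w with
  | zero =>
    intro A L h l b hw _ _ _
    have hA : A = ∅ := by
      rw [← Finset.card_eq_zero]; omega
    subst hA
    exact ⟨b, by simp, by simp⟩
  | succ w ih =>
    intro A L h l b hw hAL hAN hbag
    by_cases hroot : ∀ i ∈ A, l i = none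
    · refine ⟨b, fun i hi => ⟨_, hbag i hi⟩, fun i hi i' hi' x x' hc => ?_⟩
      have h1 := hbag i hi
      rw [hroot i hi] at h1
      have h2 := h1.eq_root
      rw [h2] at hc ⊢
      exact (code_root_left hc).symm
    push Not at hroot
    obtain ⟨i₀, hi₀, hl₀⟩ := hroot
    let J : Type := {i : I // i ∈ A ∧ l i ≠ none}
    have : Nonempty J := ⟨⟨i₀, hi₀, hl₀⟩⟩
    have hinj : Function.Injective (fun j : J => (⟨j, j.2.1⟩ : A)) :=
      fun _ _ h => Subtype.ext (congrArg (fun a : A => (a : I)) h)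
    have : Finite J := Finite.of_injective _ hinj
    have hJA : Nat.card J ≤ A.card := by
      simpa using Nat.card_le_card_of_injective _ hinj
    have hpar : ∀ j : J, ∃ l' n' lp bp e, l j = some l' ∧ h j = n' + 1 ∧ IsBag Fr Adm n' lp bp ∧
        Adm lp e l' ∧ b j = bagStep Fr l' (bp ∘ e) := by
      rintro ⟨i, hi, hli⟩
      obtain ⟨l', hl'⟩ := Option.ne_none_iff_exists'.1 hli
      have h1 := hbag i hi
      rw [hl'] at h1
      obtain ⟨n', lp, bp, e, h2, h3, h4, h5⟩ := h1.exists_parent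
      exact ⟨l', n', lp, bp, e, hl', h2, h3, h4, h5⟩
    choose lj nj lp bp e hl hh hbp hadm hb using hpar
    obtain ⟨L, rfl⟩ : ∃ L', L = L' + 1 :=
      ⟨L - 1, by have := Finset.card_pos.2 ⟨i₀, hi₀⟩; omega⟩
    by_cases hM : ∃ j j' : J, j ≠ j' ∧ ∃ z z', 
        code cl (L + 1) (Tm.null (lj j) z (bp j ∘ e j)) =
          code cl (L + 1) (Tm.null (lj j') z' (bp j' ∘ e j'))
    · -- two bags with the same label above tuples with equal codes are merged
      obtain ⟨j, j', hjj, z, z', hc⟩ := hM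
      obtain ⟨hc1, hc2, -, hc3⟩ := code_null_succ.1 hc
      have hjj' : (j : I) ≠ j' := fun h => hjj (Subtype.ext h)
      have hbb : ∀ x, code cl L (b j x) = code cl L (b j' x) := by
        intro x
        rw [hb, hb, ← hc2]
        by_cases hx : x ∈ Fr (lj j)
        · rw [bagStep_mem hx, bagStep_mem hx]
          exact hc3 x
        · rw [bagStep_notMem hx, bagStep_notMem hx]
          exact code_mono (code_null_succ.2 ⟨hc1, rfl, rfl, hc3⟩)
      -- Merging compares codes one level less precisely; losing one bag pays for this in the bound
      -- `A.card ≤ L`.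
      have hcard := Finset.card_erase_add_one j'.2.1
      obtain ⟨b'', hb1, hb2⟩ := ih (A.erase j') L h l b
        (by
          have := Finset.sum_le_sum_of_subset (f := h) (Finset.erase_subset (j' : I) A)
          omega)
        (by omega) (by omega) fun i hi => hbag i (Finset.mem_of_mem_erase hi)
      let r : I → I := fun i => if i = j' then j else i
      have hr : ∀ i ∈ A, r i ∈ A.erase j' ∧ l (r i) = l i ∧
          ∀ x, code cl L (b (r i) x) = code cl L (b i x) := by
        intro i hi
        by_cases hij : i = j'
        · simp only [r, if_pos hij]
          subst hij
          exact ⟨Finset.mem_erase.2 ⟨hjj', j.2.1⟩, by rw [hl, hl, hc2], hbb⟩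
        · simp only [r, if_neg hij]
          exact ⟨Finset.mem_erase.2 ⟨hij, hi⟩, trivial, fun _ => trivial⟩
      refine ⟨fun i => b'' (r i), fun i hi => ?_, fun i hi i' hi' x x' hc => ?_⟩
      · rw [← (hr i hi).2.1]
        exact hb1 _ (hr i hi).1
      · refine hb2 _ (hr i hi).1 _ (hr i' hi').1 x x' ?_
        rw [(hr i hi).2.2, (hr i' hi').2.2]
        exact code_mono hc
    push Not at hM
    -- a bag whose new nulls do not occur in the frontier of another bag is replaced by its parent
    obtain ⟨j, hj⟩ : ∃ j : J, ∀ (j' : J) (z x : X), z ∉ Fr (lj j) → x ∈ Fr (lj j') →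
        code cl (L + 1) (Tm.null (lj j) z (bp j ∘ e j)) ≠ code cl (L + 1) (b j' x) := by
      -- Otherwise every non-root bag has a new null reappearing in the frontier of some bag of the
      -- family. Following these reappearances in the finite set `J` gives a forbidden cycle.
      by_contra! hcon
      choose f z x _ hx hc using hcon
      refine no_short_cycle hcl (hJA.trans hAN) (hJA.trans hAL) f lj z x
        (fun j => bp j ∘ e j) fun j => ?_
      rw [hc, hb, bagStep_mem (hx j)]
    obtain ⟨b'', hb1, hb2⟩ := ih A (L + 1) (Function.update h j (nj j))
      (Function.update l j (lp j)) (Function.update b j (bp j))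
      (by
        have h1 := Finset.sum_update_of_mem j.2.1 h (nj j)
        have h2 := Finset.add_sum_erase A h j.2.1
        rw [← Finset.erase_eq] at h1
        have h3 := hh j
        omega)
      hAL hAN
      (by
        intro i hi
        by_cases hij : i = j
        · subst hij
          simpa using hbp j
        · simpa [Function.update_of_ne hij] using hbag i hi)
    have hnull : ∀ i ∈ A, ∀ z ∉ Fr (lj j), ∀ x,
        code cl (L + 1) (Tm.null (lj j) z (bp j ∘ e j)) = code cl (L + 1) (b i x) →
        i = j ∧ x = z := by
      intro i hi z hz x hc
      by_cases hli : l i = none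
      · have h1 := hbag i hi
        rw [hli] at h1
        rw [h1.eq_root] at hc
        cases code_root_left hc.symm
      · let j' : J := ⟨i, hi, hli⟩
        by_cases hx : x ∈ Fr (lj j')
        · exact absurd hc (hj j' z x hz hx)
        · have hbi : b i = bagStep Fr (lj j') (bp j' ∘ e j') := hb j'
          rw [hbi, bagStep_notMem hx] at hc
          by_cases hjj : j = j'
          · refine ⟨(congrArg Subtype.val hjj).symm, ?_⟩
            exact (code_null_succ.1 hc).2.2.1.symm
          · exact absurd hc (hM j j' hjj _ _)
    -- The bag `j` is rebuilt above its lifted parent. By `hnull` its new nulls need not be compared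
    -- with any other entry; all remaining entries already occur in the updated family.
    refine ⟨Function.update b'' j (bagStep Fr (lj j) (b'' j ∘ e j)), ?_, ?_⟩
    · intro i hi
      by_cases hij : i = j
      · subst hij
        obtain ⟨n, hn⟩ := hb1 _ hi
        rw [Function.update_self] at hn ⊢
        rw [hl]
        exact ⟨n + 1, hn.step (hadm j)⟩
      · simpa [Function.update_of_ne hij] using hb1 i hi
    · have hval : ∀ i ∈ A, ∀ x, (i = j ∧ x ∉ Fr (lj j) ∧
            b i x = Tm.null (lj j) x (bp j ∘ e j)) ∨
          ∃ y, Function.update b j (bp j) i y = b i x ∧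
            Function.update b'' j (bagStep Fr (lj j) (b'' j ∘ e j)) i x = b'' i y := by
        intro i hi x
        by_cases hij : i = j
        · subst hij
          by_cases hx : x ∈ Fr (lj j)
          · exact Or.inr ⟨e j x, by simp [hb, bagStep_mem hx], by simp [bagStep_mem hx]⟩
          · exact Or.inl ⟨rfl, hx, by rw [hb, bagStep_notMem hx]⟩
        · exact Or.inr ⟨x, by simp [Function.update_of_ne hij], by simp [Function.update_of_ne hij]⟩
      intro i hi i' hi' x x' hc
      rcases hval i hi x with ⟨h1, h2, h3⟩ | ⟨y, hy, hy'⟩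
      · rw [h3] at hc
        obtain ⟨h4, h5⟩ := hnull i' hi' x h2 x' hc
        rw [h1, h4, h5]
      rcases hval i' hi' x' with ⟨h1, h2, h3⟩ | ⟨y', hz, hz'⟩
      · rw [h3] at hc
        obtain ⟨h4, h5⟩ := hnull i hi x' h2 x hc.symm
        rw [h1, h4, h5]
      rw [hy', hz']
      exact hb2 i hi i' hi' y y' (by rw [hy, hz, hc])

end bags

/-! ### Trees and tree decompositions -/

theorem exists_path_induce {N : Type} {G : SimpleGraph N} {s : Set N}
    (h : (G.induce s).Connected) {a b : N} (ha : a ∈ s) (hb : b ∈ s) :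
    ∃ p : G.Walk a b, p.IsPath ∧ ∀ x ∈ p.support, x ∈ s := by
  obtain ⟨p, hp⟩ := h.exists_isPath ⟨a, ha⟩ ⟨b, hb⟩
  refine ⟨p.map (SimpleGraph.Embedding.induce (G := G) s).toHom,
    hp.map (SimpleGraph.Embedding.induce (G := G) s).injective, ?_⟩
  intro x hx
  obtain ⟨y, _, rfl⟩ := List.mem_map.1
    ((congrArg (x ∈ ·) (SimpleGraph.Walk.support_map _ p)).mp hx)
  exact y.2

/-- The gate of a node in a subtree: it belongs to every subtree that contains the node and meets the
given subtree. -/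
theorem exists_gate {N : Type} {G : SimpleGraph N} (hG : G.IsTree) {s : Set N}
    (hs : (G.induce s).Connected) (t : N) :
    ∃ g ∈ s, ∀ u : Set N, (G.induce u).Connected → t ∈ u → (u ∩ s).Nonempty → g ∈ u := by
  classical
  -- The gate is a node of `s` nearest to `t`. A shortest path to it meets `s` only at its end, so
  -- prolonging it inside `s` gives the unique path from `t` to `a`, which must run inside `u`.
  obtain ⟨⟨g, hg⟩, hmin⟩ : ∃ g : s, ∀ x : s, G.dist t g ≤ G.dist t x := by
    have := hs.nonempty
    exact ⟨_, fun x => Function.argmin_le (fun x : s => G.dist t x) x⟩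
  refine ⟨g, hg, fun u hu ht ⟨a, hau, has⟩ => ?_⟩
  obtain ⟨p, hp⟩ := hG.connected.exists_walk_length_eq_dist t g
  have hpp := p.isPath_of_length_eq_dist hp
  obtain ⟨q, hq, hqu⟩ := exists_path_induce hu ht hau
  obtain ⟨w, hw, hws⟩ := exists_path_induce hs hg has
  have hps : ∀ x ∈ p.support, x ∈ s → x = g := by
    intro x hx hxs
    by_contra hne
    have h1 := p.length_takeUntil_lt_length hx hne
    have h2 := SimpleGraph.dist_le (p.takeUntil x hx)
    have h3 := hmin ⟨x, hxs⟩
    simp only at h3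
    omega
  have hpw : (p.append w).IsPath := by
    rw [SimpleGraph.Walk.isPath_def, SimpleGraph.Walk.support_append, List.nodup_append']
    refine ⟨hpp.support_nodup, hw.support_nodup.tail, fun x hx hx' => ?_⟩
    have hxg := hps x hx (hws x (List.mem_of_mem_tail hx'))
    subst hxg
    have hn := hw.support_nodup
    rw [← w.cons_tail_support] at hn
    exact (List.nodup_cons.1 hn).1 hx'
  have heq : q = p.append w :=
    congrArg Subtype.val ((hG.isAcyclic.subsingleton_path _ _).elim ⟨q, hq⟩ ⟨_, hpw⟩)
  apply hqu
  rw [heq, SimpleGraph.Walk.mem_support_append_iff]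
  exact Or.inl p.end_mem_support

/-- Finite families of pairwise intersecting subtrees of a tree have a common node. -/
theorem exists_common_node {N V : Type} {G : SimpleGraph N} (hG : G.IsTree) (s : V → Set N)
    (hs : ∀ v, (G.induce (s v)).Connected) (Q : Finset V)
    (hQ : ∀ u ∈ Q, ∀ v ∈ Q, (s u ∩ s v).Nonempty) : ∃ t, ∀ v ∈ Q, t ∈ s v := by
  classical
  induction Q using Finset.induction_on with
  | empty =>
    obtain ⟨t⟩ := hG.connected.nonempty
    exact ⟨t, by simp⟩
  | insert v Q _ ih =>
    obtain ⟨t, ht⟩ := ih fun a ha b hb =>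
      hQ a (Finset.mem_insert_of_mem ha) b (Finset.mem_insert_of_mem hb)
    -- Moving the common node `t` to its gate in the new subtree does not leave the old ones.
    obtain ⟨g, hg, hgu⟩ := exists_gate hG (hs v) t
    refine ⟨g, fun u hu => ?_⟩
    rcases Finset.mem_insert.1 hu with rfl | hu
    · exact hg
    · exact hgu _ (hs u) (ht u hu)
        (hQ u (Finset.mem_insert_of_mem hu) v (Finset.mem_insert_self _ _))

/-- A finite clique is contained in a bag. -/
theorem TreeDecomposition.exists_clique_subset_bag {V : Type} {G : SimpleGraph V}
    (δ : TreeDecomposition G) {Q : Set V} (hQ : Q.Finite) (hc : G.IsClique Q) :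
    ∃ t, Q ⊆ δ.bag t := by
  obtain ⟨t, ht⟩ := exists_common_node δ.isTree (fun v => {t | v ∈ δ.bag t}) δ.connected
    hQ.toFinset (by
      intro u hu v hv
      rw [hQ.mem_toFinset] at hu hv
      by_cases huv : u = v
      · subst huv
        obtain ⟨t, ht⟩ := δ.cover u
        exact ⟨t, ht, ht⟩
      · exact δ.edge u v (hc hu hv huv))
  exact ⟨t, fun v hv => ht v (hQ.mem_toFinset.2 hv)⟩

theorem connected_induce_singleton {N : Type} (G : SimpleGraph N) (a : N) :
    (G.induce {a}).Connected :=
  have : Nonempty ({a} : Set N) := ⟨⟨a, rfl⟩⟩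
  SimpleGraph.Connected.of_subsingleton

/-- Treewidth at most `k` is witnessed by a decomposition, also for graphs without edges. -/
theorem TreewidthLE.exists_decomposition {V : Type} {G : SimpleGraph V} {k : ℕ}
    (h : TreewidthLE G k) : ∃ δ : TreeDecomposition G, δ.WidthLE k := by
  rcases h with ⟨rfl, _⟩ | ⟨_, h⟩
  · refine ⟨{ Node := Option V
              tree := SimpleGraph.starGraph none
              isTree := SimpleGraph.isTree_starGraph none
              bag := fun o => {v | o = some v}
              cover := fun v => ⟨some v, rfl⟩
              edge := fun u v h => h.elim
              connected := fun v => connected_induce_singleton _ (some v) }, ?_⟩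
    intro o
    have : ({v | o = some v} : Set V).Subsingleton := by
      intro a ha b hb
      exact Option.some_injective _ (ha.symm.trans hb)
    exact (Set.encard_le_one_iff_subsingleton.2 this).trans le_add_self
  · exact h

/-- Attach to the graph `G` new nodes, each one adjacent to its parent. -/
def attach {N M : Type} (G : SimpleGraph N) (par : M → N ⊕ M) : SimpleGraph (N ⊕ M) :=
  SimpleGraph.fromRel fun a b =>
    (∃ x y, G.Adj x y ∧ a = Sum.inl x ∧ b = Sum.inl y) ∨ ∃ m, a = Sum.inr m ∧ b = par m

section attach
variable {N M : Type} {G : SimpleGraph N} {par : M → N ⊕ M} {rk : M → ℕ}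

theorem attach_adj_inl {x y : N} : (attach G par).Adj (Sum.inl x) (Sum.inl y) ↔ G.Adj x y := by
  simp only [attach, SimpleGraph.fromRel_adj]
  constructor
  · rintro ⟨_, (⟨_, _, h, h1, h2⟩ | ⟨_, h, _⟩) | (⟨_, _, h, h1, h2⟩ | ⟨_, h, _⟩)⟩
    · cases h1; cases h2; exact h
    · cases h
    · cases h1; cases h2; exact h.symm
    · cases h
  · intro h
    exact ⟨fun h' => h.ne (Sum.inl_injective h'), Or.inl (Or.inl ⟨x, y, h, rfl, rfl⟩)⟩

theorem attach_adj_inr {m : M} {b : N ⊕ M} (h : (attach G par).Adj (Sum.inr m) b) :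
    b = par m ∨ ∃ m', b = Sum.inr m' ∧ par m' = Sum.inr m := by
  simp only [attach, SimpleGraph.fromRel_adj] at h
  obtain ⟨_, (⟨_, _, _, h1, _⟩ | ⟨_, h1, h2⟩) | (⟨_, _, _, _, h1⟩ | ⟨m', h1, h2⟩)⟩ := h
  · cases h1
  · cases h1; exact Or.inl h2
  · cases h1
  · exact Or.inr ⟨m', h1, h2.symm⟩

theorem attach_adj_par (hrk : ∀ m m', par m = Sum.inr m' → rk m' < rk m) (m : M) :
    (attach G par).Adj (Sum.inr m) (par m) := by
  simp only [attach, SimpleGraph.fromRel_adj]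
  exact ⟨fun h => lt_irrefl _ (hrk m m h.symm), Or.inl (Or.inr ⟨m, rfl, rfl⟩)⟩

/-- A set of nodes is connected if it is closed under parents, except on a connected core. -/
theorem connected_induce_attach (hrk : ∀ m m', par m = Sum.inr m' → rk m' < rk m)
    {s K : Set (N ⊕ M)} (hne : s.Nonempty) (hl : ∀ x, Sum.inl x ∈ s → Sum.inl x ∈ K)
    (hr : ∀ m, Sum.inr m ∈ s → Sum.inr m ∈ K ∨ par m ∈ s)
    (hK : ∀ a b (ha : a ∈ s) (hb : b ∈ s), a ∈ K → b ∈ K →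
      ((attach G par).induce s).Reachable ⟨a, ha⟩ ⟨b, hb⟩) :
    ((attach G par).induce s).Connected := by
  -- Climbing to parents lowers the rank, so the climb inside `s` ends in the core.
  have key : ∀ n m (hm : Sum.inr m ∈ s), rk m ≤ n → ∃ c, ∃ hc : c ∈ s, c ∈ K ∧
      ((attach G par).induce s).Reachable ⟨Sum.inr m, hm⟩ ⟨c, hc⟩ := by
    intro n
    induction n with
    | zero =>
      intro m hm hn
      rcases hr m hm with h | h
      · exact ⟨_, hm, h, SimpleGraph.Reachable.refl _⟩
      · cases hp : par m with
        | inl x =>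
          have hx : Sum.inl x ∈ s := hp ▸ h
          refine ⟨_, hx, hl x hx, SimpleGraph.Adj.reachable ?_⟩
          have := attach_adj_par (G := G) hrk m
          rw [hp] at this
          exact this
        | inr m' => have := hrk m m' hp; omega
    | succ n ih =>
      intro m hm hn
      rcases hr m hm with h | h
      · exact ⟨_, hm, h, SimpleGraph.Reachable.refl _⟩
      · have hadj := attach_adj_par (G := G) hrk m
        cases hp : par m with
        | inl x =>
          rw [hp] at h hadj
          exact ⟨_, h, hl x h, SimpleGraph.Adj.reachable hadj⟩
        | inr m' =>
          have := hrk m m' hp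
          rw [hp] at h hadj
          obtain ⟨c, hc, hcK, hcr⟩ := ih m' h (by omega)
          refine ⟨c, hc, hcK, SimpleGraph.Reachable.trans (SimpleGraph.Adj.reachable ?_) hcr⟩
          exact hadj
  have key' : ∀ a (ha : a ∈ s), ∃ c, ∃ hc : c ∈ s, c ∈ K ∧
      ((attach G par).induce s).Reachable ⟨a, ha⟩ ⟨c, hc⟩ := by
    rintro (x | m) ha
    · exact ⟨_, ha, hl x ha, SimpleGraph.Reachable.refl _⟩
    · exact key _ m ha le_rfl
  have : Nonempty s := hne.to_subtype
  refine ⟨?_⟩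
  rintro ⟨a, ha⟩ ⟨b, hb⟩
  obtain ⟨c, hc, hcK, hac⟩ := key' a ha
  obtain ⟨d, hd, hdK, hbd⟩ := key' b hb
  exact hac.trans ((hK c d hc hd hcK hdK).trans hbd.symm)

/-- On a cycle, a node of maximal rank that is new would have its parent as both cycle neighbours.
If no node of the cycle is new, the cycle lies in `G`. -/
theorem isTree_attach (hG : G.IsTree) (hrk : ∀ m m', par m = Sum.inr m' → rk m' < rk m) :
    (attach G par).IsTree := by
  classical
  refine ⟨?_, ?_⟩
  · rw [← (SimpleGraph.induceUnivIso (attach G par)).connected_iff]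
    obtain ⟨x⟩ := hG.connected.nonempty
    refine connected_induce_attach hrk (K := Set.range Sum.inl) ⟨Sum.inl x, trivial⟩
      (fun x _ => ⟨x, rfl⟩) (fun _ _ => Or.inr trivial) ?_
    rintro _ _ _ _ ⟨x, rfl⟩ ⟨y, rfl⟩
    exact (hG.connected x y).map
      (⟨fun x => ⟨Sum.inl x, trivial⟩, fun h => attach_adj_inl.2 h⟩ :
        G →g (attach G par).induce Set.univ)
  · intro u p hp
    let rk' : N ⊕ M → ℕ := Sum.elim (fun _ => 0) (fun m => rk m + 1)
    obtain ⟨w, hw, hmax⟩ := p.support.toFinset.exists_max_image rk'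
      ⟨u, by simp⟩
    rw [List.mem_toFinset] at hw
    have hmax : ∀ v ∈ p.support, rk' v ≤ rk' w := fun v hv => hmax v (by simpa using hv)
    cases w with
    | inl x =>
      have hsupp : ∀ v ∈ p.support, v ∈ {a : N ⊕ M | a.isLeft} := by
        rintro (y | m) hv
        · rfl
        · have := hmax _ hv
          simp [rk'] at this
      have hac : ((attach G par).induce {a : N ⊕ M | a.isLeft}).IsAcyclic := by
        refine hG.isAcyclic.comap ⟨fun a => a.1.getLeft a.2, ?_⟩ ?_
        · rintro ⟨y | m, hy⟩ ⟨y' | m', hy'⟩ h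
          · exact attach_adj_inl.1 h
          · cases hy'
          · cases hy
          · cases hy
        · rintro ⟨y | m, hy⟩ ⟨y' | m', hy'⟩ h
          · simp only [RelHom.coeFn_mk, Sum.getLeft_inl] at h
            subst h; rfl
          · cases hy'
          · cases hy
          · cases hy
      refine hac (p.induce _ hsupp) ?_
      rw [← SimpleGraph.Walk.isCycle_map_iff_of_injective
        (f := (SimpleGraph.Embedding.induce (G := attach G par) {a : N ⊕ M | a.isLeft}).toHom)
        (SimpleGraph.Embedding.induce (G := attach G par) _).injective, SimpleGraph.Walk.map_induce]
      exact hp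
    | inr m =>
      have hq := hp.rotate hw
      have hmem : ∀ v ∈ (p.rotate _ hw).support, v ∈ p.support := fun v hv => by
        simpa using hv
      have hpar : ∀ v ∈ (p.rotate _ hw).support, (attach G par).Adj (Sum.inr m) v →
          v = par m := by
        intro v hv hadj
        rcases attach_adj_inr hadj with h | ⟨m', rfl, h⟩
        · exact h
        · have h1 := hmax _ (hmem _ hv)
          have h2 := hrk _ _ h
          simp only [rk', Sum.elim_inr] at h1
          omega
      apply hq.snd_ne_penultimate
      rw [hpar _ (List.mem_of_mem_tail (SimpleGraph.Walk.snd_mem_tail_support hq.not_nil))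
          (SimpleGraph.Walk.adj_snd hq.not_nil),
        hpar _ (List.mem_of_mem_dropLast
            (SimpleGraph.Walk.penultimate_mem_dropLast_support hq.not_nil))
          (SimpleGraph.Walk.adj_penultimate hq.not_nil).symm]

end attach

/-! ### Renaming and counting terms of atoms -/

theorem Atom.map_map {T : Schema} {α β γ : Type} (g : β → γ) (f : α → β) (a : Atom T α) :
    (a.map f).map g = a.map (g ∘ f) := rfl

theorem Atom.map_congr {T : Schema} {α β : Type} {f g : α → β} {a : Atom T α}
    (h : ∀ i, f (a.args i) = g (a.args i)) : a.map f = a.map g := by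
  simp only [Atom.map, h]

theorem Atom.map_eq_map {T : Schema} {α β γ : Type} {f : α → γ} {g : β → γ} {a : Atom T α}
    {b : Atom T β} (h : a.map f = b.map g) :
    ∃ hr : a.rel = b.rel, ∀ i, f (a.args i) = g (b.args (Fin.cast (congrArg T.ar hr) i)) := by
  obtain ⟨r, s⟩ := a
  obtain ⟨r', s'⟩ := b
  simp only [Atom.map, Atom.mk.injEq] at h
  obtain ⟨rfl, h⟩ := h
  exact ⟨rfl, fun i => congrFun (eq_of_heq h) i⟩

theorem Atom.map_eq_of_args {T : Schema} {α β γ : Type} {f : α → γ} {g : β → γ} {a : Atom T α}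
    {b : Atom T β} (hr : a.rel = b.rel)
    (h : ∀ i, f (a.args i) = g (b.args (Fin.cast (congrArg T.ar hr) i))) : a.map f = b.map g := by
  obtain ⟨r, s⟩ := a
  obtain ⟨r', s'⟩ := b
  cases hr
  simp only [Atom.map, Atom.mk.injEq, heq_eq_eq, true_and]
  exact funext h

theorem args_mem_adom {T : Schema} {α : Type} {A : Set (Atom T α)} {a : Atom T α} (ha : a ∈ A)
    (i : Fin (T.ar a.rel)) : a.args i ∈ adom A := mem_adom.2 ⟨a, ha, i, rfl⟩

theorem encard_adom_le {T : Schema} {α : Type} {A : Set (Atom T α)} (hA : A.Finite) {r m : ℕ}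
    (hr : ∀ R, T.ar R ≤ r) (hm : A.ncard ≤ m) : (adom A).encard ≤ (r * m : ℕ) := by
  classical
  have h1 : adom A = ⋃ a ∈ hA.toFinset, (Finset.univ.image a.args : Set α) := by
    ext v
    simp [adom, Atom.terms]
  have h2 : adom A = ((hA.toFinset.biUnion fun a => Finset.univ.image a.args : Finset α) : Set α) := by
    rw [h1]
    simp
  rw [h2, Set.encard_coe_eq_coe_finsetCard, Nat.cast_le]
  refine (Finset.card_biUnion_le_card_mul _ _ r fun a _ => ?_).trans ?_
  · exact Finset.card_image_le.trans (by simpa using hr a.rel)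
  · rw [← Set.ncard_eq_toFinset_card A hA, mul_comm]
    exact Nat.mul_le_mul_left _ hm

/-! ### Contractions -/

/-- A homomorphism that is injective on the answer variables factors through a contraction on which
it is injective. -/
theorem CQ.exists_contraction_injOn {T : Schema} {n : ℕ} (q : CQ T n) {β : Type} {g : Var → β}
    {A : Set (Atom T β)} (hg : IsHom g q.atoms A)
    (hans : Function.Injective fun i => g (q.ans i)) :
    ∃ p : CQ T n, q.IsContraction p ∧ IsHom g p.atoms A ∧ Set.InjOn g (adom p.atoms) := by
  classical
  -- A class containing an answer variable is represented by it, as contractions demand; `hans`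
  -- makes this variable unique.
  let rep : β → Var := fun y =>
    if h : ∃ i, g (q.ans i) = y then q.ans h.choose else Function.invFunOn g (adom q.atoms) y
  have hrep : ∀ v ∈ adom q.atoms, rep (g v) ∈ adom q.atoms ∧ g (rep (g v)) = g v := by
    intro v hv
    by_cases h : ∃ i, g (q.ans i) = g v
    · simp only [rep, dif_pos h]
      exact ⟨q.occurs _, h.choose_spec⟩
    · simp only [rep, dif_neg h]
      exact ⟨Function.invFunOn_mem ⟨v, hv, rfl⟩, Function.invFunOn_eq ⟨v, hv, rfl⟩⟩
  have hrepa : ∀ i, rep (g (q.ans i)) = q.ans i := by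
    intro i
    have h : ∃ j, g (q.ans j) = g (q.ans i) := ⟨i, rfl⟩
    simp only [rep, dif_pos h]
    exact congrArg q.ans (hans h.choose_spec)
  let f : Var → Var := fun v => rep (g v)
  let p : CQ T n :=
    { ans := q.ans
      atoms := Atom.map f '' q.atoms
      finite := q.finite.image _
      injective := q.injective
      occurs := fun i => by
        rw [adom_image]
        exact ⟨q.ans i, q.occurs i, hrepa i⟩ }
  refine ⟨p, ⟨f, fun v hv => ⟨(hrep v hv).1, ?_⟩, hrepa, rfl, rfl⟩, ?_, ?_⟩
  · exact congrArg rep (hrep v hv).2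
  · rintro _ ⟨a, ha, rfl⟩
    have : (a.map f).map g = a.map g :=
      Atom.map_congr (f := g ∘ f) fun i => (hrep _ (args_mem_adom ha i)).2
    rw [this]
    exact hg a ha
  · change Set.InjOn g (adom (Atom.map f '' q.atoms))
    rw [adom_image]
    rintro _ ⟨v, hv, rfl⟩ _ ⟨w, hw, rfl⟩ h
    have h' : g v = g w := by rw [← (hrep v hv).2, ← (hrep w hw).2]; exact h
    exact congrArg rep h'

theorem CQ.IsContraction.eval_subset {T : Schema} {n : ℕ} {q p : CQ T n} (h : q.IsContraction p)
    (I : Inst T) : p.eval I ⊆ q.eval I := by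
  obtain ⟨f, _, hfa, hans, hatoms⟩ := h
  rintro c ⟨g, hg, hgc⟩
  refine ⟨g ∘ f, fun a ha => ?_, fun i => ?_⟩
  · exact hg (a.map f) (hatoms ▸ ⟨a, ha, rfl⟩)
  · rw [Function.comp_apply, hfa, ← hgc, hans]

/-- Tree decompositions are inherited along injective homomorphisms. -/
theorem TreeDecomposition.exists_comap {V W : Type} {G : SimpleGraph V} {H : SimpleGraph W}
    (δ : TreeDecomposition G) {k : ℕ} (hδ : δ.WidthLE k) (f : H →g G)
    (hf : Function.Injective f) : ∃ δ' : TreeDecomposition H, δ'.WidthLE k :=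
  ⟨{ Node := δ.Node
     tree := δ.tree
     isTree := δ.isTree
     bag := fun t => f ⁻¹' δ.bag t
     cover := fun v => δ.cover (f v)
     edge := fun _ _ h => δ.edge _ _ (f.map_adj h)
     connected := fun v => δ.connected (f v) },
   fun t => (hf.encard_image _).symm.le.trans
     ((Set.encard_le_encard (Set.image_preimage_subset f (δ.bag t))).trans (hδ t))⟩

/-! ### The chase of a query over a model -/

/-- Finitely many constraints, and a homomorphism `base` from the finite set `atoms` to the database
`target`; all relevant variables are at most `bound`. -/
structure ChaseData (T : Schema) where
  constraints : Set (TGD T)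
  atoms : Set (Atom T Var)
  target : Inst T
  base : Var → Const
  bound : ℕ
  le_bound : ∀ v ∈ adom atoms, v ≤ bound
  le_bound_head : ∀ σ ∈ constraints, ∀ v ∈ adom σ.head, v ≤ bound
  isHom : IsHom base atoms target

namespace ChaseData
variable {T : Schema} (E : ChaseData T)

/-- Positions in bags. -/
abbrev Pos : Type := Fin (E.bound + 1)

/-- The position of a variable. -/
def pos (v : Var) : E.Pos := Fin.ofNat (E.bound + 1) v

theorem pos_val (v : Var) (hv : v ≤ E.bound) : (E.pos v : ℕ) = v :=
  Nat.mod_eq_of_lt (Nat.lt_succ_of_le hv)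

/-- A label consists of a constraint and an image of its head in the target. -/
abbrev Label : Type :=
  {σ // σ ∈ E.constraints} × (E.Pos → (insert 0 (adom E.target) : Set Const))

/-- The atoms of a bag. -/
def hd : Option E.Label → Set (Atom T Var)
  | none => E.atoms
  | some l => l.1.1.head

/-- The images of the positions of a bag in the target. -/
def col : Option E.Label → E.Pos → Const
  | none => fun x => E.base x
  | some l => fun x => l.2 x

/-- The frontier positions of a bag. -/
def Fr (l : E.Label) : Set E.Pos := {x | (x : ℕ) ∈ l.1.1.frontier}

/-- Below a bag with label `l` there is one with label `l'` above the tuple of positions `e`. -/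
def Adm (l : Option E.Label) (e : E.Pos → E.Pos) (l' : E.Label) : Prop :=
  (∀ x ∈ E.Fr l', E.col (some l') x = E.col l (e x)) ∧
  IsHom (E.col (some l') ∘ E.pos) l'.1.1.head E.target ∧
  -- The guard: the frontier comes from a single atom of the parent bag, hence from a clique.
  (E.Fr l' = ∅ ∨ ∃ a ∈ E.hd l, ∀ x ∈ E.Fr l', ∃ i, e x = E.pos (a.args i))

abbrev Term : Type := Tm E.Pos E.Label

/-- The bags of the chase. -/
abbrev Bag : ℕ → Option E.Label → (E.Pos → E.Term) → Prop := IsBag E.Fr E.Adm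

/-- The image of a term in the target. -/
def proj : E.Term → Const
  | .root x => E.col none x
  | .null l z _ => E.col (some l) z

/-- The atoms of the chase. -/
def chase : Set (Atom T E.Term) :=
  {α | ∃ n l b, E.Bag n l b ∧ ∃ a ∈ E.hd l, α = a.map (b ∘ E.pos)}

variable {E}

theorem proj_bag {n : ℕ} {l : Option E.Label} {b : E.Pos → E.Term} (h : E.Bag n l b) (x : E.Pos) :
    E.proj (b x) = E.col l x := by
  induction h generalizing x with
  | root => rfl
  | @step n l b e l' _ hadm ih =>
    by_cases hx : x ∈ E.Fr l'
    · rw [bagStep_mem hx, Function.comp_apply, ih, hadm.1 x hx]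
    · rw [bagStep_notMem hx]; rfl

variable (E)

theorem isHom_proj : IsHom E.proj E.chase E.target := by
  rintro _ ⟨n, l, b, hb, a, ha, rfl⟩
  have h1 : (a.map (b ∘ E.pos)).map E.proj = a.map (E.col l ∘ E.pos) :=
    Atom.map_congr (f := E.proj ∘ b ∘ E.pos) fun i => proj_bag hb _
  rw [h1]
  cases l with
  | none =>
    have : a.map (E.col none ∘ E.pos) = a.map E.base := Atom.map_congr fun i => by
      change E.base (E.pos (a.args i) : ℕ) = _
      rw [E.pos_val _ (E.le_bound _ (args_mem_adom ha i))]
    rw [this]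
    exact E.isHom a ha
  | some l =>
    obtain ⟨_, _, _, _, _, _, hadm, _⟩ := hb.exists_parent
    exact hadm.2.1 a ha

/-- Homomorphic images of the chase that preserve projections satisfy the constraints satisfied by
the target. -/
theorem sat_image {ρ : E.Term → Const} (hρ : ∀ s s', ρ s = ρ s' → E.proj s = E.proj s')
    {σ : TGD T} (hσ : σ ∈ E.constraints) (hfg : σ.FrontierGuarded) (hsat : σ.Sat E.target) :
    σ.Sat (Atom.map ρ '' E.chase) := by
  classical
  intro h hh
  -- Since `ρ` merges only terms with equal projections, `proj` factors through it as `π`. A body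
  -- match in the image thus becomes one in the target, where the constraint supplies a head match
  -- to serve as the label of a new bag.
  let π : Const → Const := fun d => if hd : ∃ s, ρ s = d then E.proj hd.choose else 0
  have hπ : ∀ s, π (ρ s) = E.proj s := by
    intro s
    have hd : ∃ s', ρ s' = ρ s := ⟨s, rfl⟩
    simp only [π, dif_pos hd]
    exact hρ _ _ hd.choose_spec
  have hhom : IsHom (π ∘ h) σ.body E.target := by
    intro a ha
    obtain ⟨α, hα, he⟩ := hh a ha
    have : a.map (π ∘ h) = α.map E.proj := by
      rw [← Atom.map_map, ← he, Atom.map_map]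
      exact Atom.map_congr fun i => hπ _
    rw [this]
    exact E.isHom_proj α hα
  obtain ⟨h', heq, hh'⟩ := hsat _ hhom
  -- Positions that are not variables of the head may have values outside the target; they receive
  -- the dummy `0`.
  let l' : E.Label := ⟨⟨σ, hσ⟩, fun x => if hx : h' x ∈ adom E.target then ⟨h' x, Or.inr hx⟩
    else ⟨0, Or.inl rfl⟩⟩
  have hcol : ∀ v ∈ adom σ.head, E.col (some l') (E.pos v) = h' v := by
    intro v hv
    obtain ⟨a, ha, i, rfl⟩ := mem_adom.1 hv
    have hx : h' (a.args i) ∈ adom E.target := args_mem_adom (hh' a ha) i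
    change ((l'.2 (E.pos (a.args i)) : _) : Const) = _
    simp only [l']
    rw [E.pos_val _ (E.le_bound_head σ hσ _ hv), dif_pos hx]
  have hhom' : IsHom (E.col (some l') ∘ E.pos) σ.head E.target := by
    intro a ha
    have : a.map (E.col (some l') ∘ E.pos) = a.map h' :=
      Atom.map_congr fun i => hcol _ (args_mem_adom ha i)
    rw [this]
    exact hh' a ha
  have hposFr : ∀ v ∈ adom σ.head, E.pos v ∈ E.Fr l' ↔ v ∈ σ.frontier := by
    intro v hv
    change (E.pos v : ℕ) ∈ σ.frontier ↔ _
    rw [E.pos_val _ (E.le_bound_head σ hσ _ hv)]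
  have hFrpos : ∀ x ∈ E.Fr l', ∃ v ∈ σ.frontier, x = E.pos v := by
    intro x hx
    refine ⟨x, hx, ?_⟩
    ext
    rw [E.pos_val _ (Nat.lt_succ_iff.1 x.2)]
  -- a bag and a tuple of positions that match the frontier
  obtain ⟨n, l, b, e, hb, hadm, hval⟩ : ∃ n l b e, E.Bag n l b ∧ E.Adm l e l' ∧
      ∀ v ∈ σ.frontier, ρ (b (e (E.pos v))) = h v := by
    rcases hfg with hemp | ⟨α, hα, hfr⟩
    · have hF : σ.frontier = ∅ := by simp [TGD.frontier, hemp, adom]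
      have hF' : E.Fr l' = ∅ := by
        ext x
        change (x : ℕ) ∈ σ.frontier ↔ _
        simp [hF]
      refine ⟨0, none, _, id, IsBag.root, ⟨?_, hhom', Or.inl hF'⟩, by simp [hF]⟩
      simp [hF']
    -- The guard is matched to the image of one chase atom, so a single bag contains preimages of
    -- all frontier values.
    · obtain ⟨_, ⟨n, l, b, hb, a, ha, rfl⟩, he⟩ := hh α hα
      obtain ⟨hr, hargs⟩ := Atom.map_eq_map (f := ρ ∘ b ∘ E.pos) he
      have hex : ∀ x : E.Pos, ∃ y : E.Pos, x ∈ E.Fr l' →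
          (∃ i, y = E.pos (a.args i)) ∧ ρ (b y) = h x := by
        intro x
        by_cases hx : x ∈ E.Fr l'
        · obtain ⟨i, hi⟩ := hfr hx
          refine ⟨E.pos (a.args (Fin.cast (congrArg T.ar hr.symm) i)), fun _ => ⟨⟨_, rfl⟩, ?_⟩⟩
          have := hargs (Fin.cast (congrArg T.ar hr.symm) i)
          rw [← hi]
          simpa using this
        · exact ⟨x, fun h => absurd h hx⟩
      choose e he using hex
      have hv : ∀ v ∈ σ.frontier, ρ (b (e (E.pos v))) = h v := by
        intro v hv
        have := (he (E.pos v) ((hposFr v hv.2).2 hv)).2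
        rwa [E.pos_val _ (E.le_bound_head σ hσ _ hv.2)] at this
      refine ⟨n, l, b, e, hb, ⟨?_, hhom', Or.inr ⟨a, ha, fun x hx => (he x hx).1⟩⟩, hv⟩
      intro x hx
      obtain ⟨v, hvf, rfl⟩ := hFrpos x hx
      rw [hcol v hvf.2, ← proj_bag hb, ← hπ, hv v hvf]
      exact heq hvf
  refine ⟨fun v => ρ (bagStep E.Fr l' (b ∘ e) (E.pos v)), fun v hv => ?_, fun a ha => ?_⟩
  · have : E.pos v ∈ E.Fr l' := (hposFr v hv.2).2 hv
    simp only [bagStep_mem this]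
    exact hval v hv
  · exact ⟨_, ⟨n + 1, some l', _, hb.step hadm, a, ha, rfl⟩, rfl⟩

/-- The chase has finite homomorphic images over which small queries have the same answers among
the root elements as over the chase. -/
theorem exists_finite_image (hC : E.constraints.Finite) (hD : E.target.Finite) (N : ℕ) :
    ∃ ρ : E.Term → Const, (Set.range ρ).Finite ∧ (∀ s s', ρ s = ρ s' → E.proj s = E.proj s') ∧
      ∀ A : Set (Atom T Var), A.Finite → A.ncard ≤ N → ∀ g : Var → Const,
        IsHom g A (Atom.map ρ '' E.chase) →
        ∃ g' : Var → E.Term, IsHom g' A E.chase ∧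
          ∀ v ∈ adom A, ∀ x, g v = ρ (Tm.root x) → g' v = Tm.root x := by
  classical
  have : Finite {σ // σ ∈ E.constraints} := hC
  have : Finite (insert 0 (adom E.target) : Set Const) := (adom_finite hD).insert 0
  -- The extra one accounts for the root bag, which joins the bags of the at most `N` atoms so that
  -- root elements are preserved. It also makes the depth positive, so that codes determine
  -- projections.
  obtain ⟨c, cl, hcl⟩ := exists_proper E.Pos E.Label (N + 1)
  have hfin := finite_code E.Pos E.Label (Fin c) (N + 1)
  obtain ⟨m, ⟨enc⟩⟩ := Finite.exists_equiv_fin (Code E.Pos E.Label (Fin c) (N + 1))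
  let ρ : E.Term → Const := fun s => (enc (code cl (N + 1) s) : ℕ)
  have hρ : ∀ s s', ρ s = ρ s' → code cl (N + 1) s = code cl (N + 1) s' :=
    fun s s' h => enc.injective (Fin.ext h)
  refine ⟨ρ, ?_, ?_, ?_⟩
  · refine (Set.finite_range (fun x : Fin m => (x : ℕ))).subset ?_
    rintro _ ⟨s, rfl⟩
    exact ⟨_, rfl⟩
  · intro s s' h
    have h := hρ s s' h
    cases s with
    | root x => rw [code_root_left h]
    | null l z t =>
      cases s' with
      | root x => cases code_root_left h.symm
      | null l' z' t' =>
        obtain ⟨_, rfl, rfl, _⟩ := code_null_succ.1 h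
        rfl
  · intro A hA hAN g hg
    choose α hα hαg using hg
    choose n l b hb a ha hαa using hα
    have : Finite A := hA
    have := Fintype.ofFinite A
    -- the bags of the atoms, together with the root bag
    obtain ⟨b', hb1, hb2⟩ := exists_lift (Fr := E.Fr) (Adm := E.Adm) hcl (I := Option A) _
      Finset.univ (N + 1)
      (fun o => o.elim 0 fun x => n x x.2) (fun o => o.elim none fun x => l x x.2)
      (fun o => o.elim Tm.root fun x => b x x.2) le_rfl
      (by
        rw [Finset.card_univ, Fintype.card_option, ← Nat.card_eq_fintype_card,
          Nat.card_coe_set_eq]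
        omega)
      (by
        rw [Finset.card_univ, Fintype.card_option, ← Nat.card_eq_fintype_card,
          Nat.card_coe_set_eq]
        omega)
      (by
        rintro (_ | x) _
        · exact IsBag.root
        · exact hb x x.2)
    have hroot : b' none = Tm.root := by
      obtain ⟨_, h⟩ := hb1 none (Finset.mem_univ _)
      exact h.eq_root
    have hargs : ∀ x (hx : x ∈ A), ∃ hr : (a x hx).rel = x.rel, ∀ i,
        ρ (b x hx (E.pos ((a x hx).args i))) =
          g (x.args (Fin.cast (congrArg T.ar hr) i)) := by
      intro x hx
      refine Atom.map_eq_map (f := ρ ∘ b x hx ∘ E.pos) ?_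
      rw [← hαg x hx, hαa x hx]
      rfl
    -- The occurrences of a variable in different atoms have equal codes, so the lifted bags agree
    -- on them and the value is well defined.
    have hex : ∀ v, ∃ s : E.Term, ∀ x (hx : x ∈ A) i,
        v = x.args (Fin.cast (congrArg T.ar (hargs x hx).1) i) →
        s = b' (some ⟨x, hx⟩) (E.pos ((a x hx).args i)) := by
      intro v
      by_cases hv : ∃ x, ∃ hx : x ∈ A, ∃ i, v = x.args (Fin.cast (congrArg T.ar (hargs x hx).1) i)
      · obtain ⟨x, hx, i, hi⟩ := hv
        refine ⟨b' (some ⟨x, hx⟩) (E.pos ((a x hx).args i)), fun y hy j hj => ?_⟩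
        refine hb2 _ (Finset.mem_univ _) _ (Finset.mem_univ _) _ _ (hρ _ _ ?_)
        change ρ (b x hx _) = ρ (b y hy _)
        rw [(hargs x hx).2, (hargs y hy).2, ← hi, ← hj]
      · refine ⟨b' none 0, fun x hx i hi => absurd ⟨x, hx, i, hi⟩ hv⟩
    choose g' hg' using hex
    refine ⟨g', fun x hx => ?_, fun v hv y hy => ?_⟩
    · obtain ⟨k, hk⟩ := hb1 (some ⟨x, hx⟩) (Finset.mem_univ _)
      refine ⟨k, _, _, hk, a x hx, ha x hx, ?_⟩
      exact (Atom.map_eq_of_args (f := b' (some ⟨x, hx⟩) ∘ E.pos) (hargs x hx).1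
        fun i => (hg' _ x hx i rfl).symm).symm
    · obtain ⟨x, hx, i, rfl⟩ := mem_adom.1 hv
      have hi : x.args i = x.args (Fin.cast (congrArg T.ar (hargs x hx).1)
          (Fin.cast (congrArg T.ar (hargs x hx).1.symm) i)) := by simp
      rw [hg' _ x hx _ hi]
      have h := hb2 (some ⟨x, hx⟩) (Finset.mem_univ _) none (Finset.mem_univ _)
        (E.pos ((a x hx).args (Fin.cast (congrArg T.ar (hargs x hx).1.symm) i))) y (hρ _ _ (by
          change ρ (b x hx _) = ρ (Tm.root y)
          rw [(hargs x hx).2, ← hy, ← hi]))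
      rw [h, hroot]


/-- Without the root elements of some variables (among them all answer variables, say), the chase has
a tree decomposition as narrow as the root bag and the heads allow. -/
theorem exists_decomposition {R : Set Var} {k : ℕ}
    (htw : TreewidthLE ((gaifman E.atoms).induce (adom E.atoms \ R)) k)
    (hhead : ∀ σ ∈ E.constraints, (adom σ.head).encard ≤ (k : ℕ∞) + 1) :
    ∃ δ : TreeDecomposition
      ((gaifman E.chase).induce (adom E.chase \ (fun v => Tm.root (E.pos v)) '' R)),
      δ.WidthLE k := by
  classical
  obtain ⟨δ₀, hδ₀⟩ := htw.exists_decomposition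
  let W : Set E.Term := adom E.chase \ (fun v => Tm.root (E.pos v)) '' R
  let M : Type := {x : E.Label × (E.Pos → E.Term) // ∃ n, E.Bag n (some x.1) x.2}
  -- A bag may have several derivations; taking parents from one of minimal height makes the rank
  -- drop.
  let rk : M → ℕ := fun m => Nat.find m.2
  let bag : δ₀.Node ⊕ M → Set W := Sum.elim
    (fun t => {y | ∃ v, v ∈ δ₀.bag t ∧ y.1 = Tm.root (E.pos v)})
    (fun m => {y | ∃ v ∈ adom m.1.1.1.1.head, y.1 = m.1.2 (E.pos v)})
  have hinl : ∀ t y, y ∈ bag (Sum.inl t) ↔ ∃ v, v ∈ δ₀.bag t ∧ y.1 = Tm.root (E.pos v) :=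
    fun _ _ => Iff.rfl
  have hinr : ∀ m y, y ∈ bag (Sum.inr m) ↔ ∃ v ∈ adom m.1.1.1.1.head, y.1 = m.1.2 (E.pos v) :=
    fun _ _ => Iff.rfl
  have hrootR : ∀ v, Tm.root (E.pos v) ∈ W → v ∉ R := fun v hv hR => hv.2 ⟨v, hR, rfl⟩
  -- Every term of a bag is either created there or already in the bag of the parent node.
  have hpar : ∀ m : M, ∃ q : δ₀.Node ⊕ M, (∀ m', q = Sum.inr m' → rk m' < rk m) ∧
      ∀ y ∈ bag (Sum.inr m),
        (∃ z t, y.1 = Tm.null m.1.1 z t ∧ m.1.2 = bagStep E.Fr m.1.1 t) ∨ y ∈ bag q := by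
    intro m
    obtain ⟨n', l, b, e, hn, hb, hadm, hmb⟩ := (Nat.find_spec m.2).exists_parent
    have hnull : ∀ v, E.pos v ∉ E.Fr m.1.1 → ∃ z t,
        m.1.2 (E.pos v) = Tm.null m.1.1 z t ∧ m.1.2 = bagStep E.Fr m.1.1 t := by
      intro v hv
      exact ⟨E.pos v, b ∘ e, by rw [hmb, bagStep_notMem hv], hmb⟩
    rcases hadm.2.2 with hF | ⟨a, ha, hae⟩
    -- With empty frontier all terms are new, so any node can be the parent.
    · obtain ⟨t₀⟩ := δ₀.isTree.connected.nonempty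
      refine ⟨Sum.inl t₀, fun _ h => (by cases h), fun y hy => Or.inl ?_⟩
      obtain ⟨v, _, hyv⟩ := (hinr m y).1 hy
      rw [hyv]
      exact hnull v (by simp [hF])
    cases l with
    | none =>
      obtain ⟨t, ht⟩ := δ₀.exists_clique_subset_bag
        (Q := {w | w.1 ∈ a.terms}) ((Set.finite_range a.args).preimage
          Subtype.val_injective.injOn) (by
            intro u hu v hv huv
            exact ⟨fun h => huv (Subtype.ext h), a, ha, hu, hv⟩)
      refine ⟨Sum.inl t, fun _ h => (by cases h), fun y hy => ?_⟩
      obtain ⟨v, _, hyv⟩ := (hinr m y).1 hy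
      by_cases hv : E.pos v ∈ E.Fr m.1.1
      · obtain ⟨i, hi⟩ := hae _ hv
        have hyr : y.1 = Tm.root (E.pos (a.args i)) := by
          rw [hyv, hmb, bagStep_mem hv, Function.comp_apply, hb.eq_root, hi]
        have hnR := hrootR (a.args i) (hyr ▸ y.2)
        exact Or.inr ((hinl t y).2 ⟨⟨a.args i, args_mem_adom ha i, hnR⟩, ht ⟨i, rfl⟩, hyr⟩)
      · rw [hyv]
        exact Or.inl (hnull v hv)
    | some l =>
      refine ⟨Sum.inr ⟨(l, b), n', hb⟩, ?_, fun y hy => ?_⟩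
      · intro m' hm'
        cases hm'
        have h1 : rk ⟨(l, b), n', hb⟩ ≤ n' := Nat.find_min' _ hb
        have h2 : rk m = n' + 1 := hn
        omega
      · obtain ⟨v, _, hyv⟩ := (hinr m y).1 hy
        by_cases hv : E.pos v ∈ E.Fr m.1.1
        · obtain ⟨i, hi⟩ := hae _ hv
          refine Or.inr ((hinr _ y).2 ⟨a.args i, args_mem_adom ha i, ?_⟩)
          rw [hyv, hmb, bagStep_mem hv, Function.comp_apply, hi]
        · rw [hyv]
          exact Or.inl (hnull v hv)
  choose par hrk hparbag using hpar
  have hatom : ∀ α ∈ E.chase,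
      (∃ a ∈ E.atoms, ∀ y : W, y.1 ∈ α.terms →
        ∃ v : ↥(adom E.atoms \ R), v.1 ∈ a.terms ∧ y.1 = Tm.root (E.pos v)) ∨
      ∃ m, ∀ y : W, y.1 ∈ α.terms → y ∈ bag (Sum.inr m) := by
    rintro _ ⟨n, l, b, hb, a, ha, rfl⟩
    cases l with
    | none =>
      refine Or.inl ⟨a, ha, fun y hy => ?_⟩
      obtain ⟨i, hi⟩ := hy
      have hi : Tm.root (E.pos (a.args i)) = y.1 := by
        rw [← hi, hb.eq_root]; rfl
      exact ⟨⟨a.args i, args_mem_adom ha i, hrootR _ (hi ▸ y.2)⟩, ⟨i, rfl⟩, hi.symm⟩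
    | some l =>
      refine Or.inr ⟨⟨(l, b), n, hb⟩, fun y hy => ?_⟩
      obtain ⟨i, hi⟩ := hy
      exact (hinr _ y).2 ⟨a.args i, args_mem_adom ha i, hi.symm⟩
  have hcover : ∀ y : W, ∃ t, y ∈ bag t := by
    intro y
    obtain ⟨α, hα, i, hi⟩ := mem_adom.1 y.2.1
    rcases hatom α hα with ⟨a, ha, h⟩ | ⟨m, h⟩
    · obtain ⟨v, _, hv⟩ := h y ⟨i, hi⟩
      obtain ⟨t, ht⟩ := δ₀.cover v
      exact ⟨Sum.inl t, (hinl t y).2 ⟨v, ht, hv⟩⟩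
    · exact ⟨Sum.inr m, h y ⟨i, hi⟩⟩
  refine ⟨{ Node := δ₀.Node ⊕ M
            tree := attach δ₀.tree par
            isTree := isTree_attach δ₀.isTree hrk
            bag := bag
            cover := hcover
            edge := ?_
            connected := ?_ }, ?_⟩
  · rintro y y' ⟨hne, α, hα, hy, hy'⟩
    rcases hatom α hα with ⟨a, ha, h⟩ | ⟨m, h⟩
    · obtain ⟨v, hva, hv⟩ := h y hy
      obtain ⟨v', hva', hv'⟩ := h y' hy'
      have hvv : v.1 ≠ v'.1 := by
        intro h
        apply hne
        change y.1 = y'.1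
        rw [hv, hv', h]
      obtain ⟨t, ht, ht'⟩ := δ₀.edge v v' ⟨hvv, a, ha, hva, hva'⟩
      exact ⟨Sum.inl t, (hinl t y).2 ⟨v, ht, hv⟩, (hinl t y').2 ⟨v', ht', hv'⟩⟩
    · exact ⟨Sum.inr m, h y hy, h y' hy'⟩
  · intro y
    obtain ⟨t₀, ht₀⟩ := hcover y
    cases hy : y.1 with
    | root x =>
      refine connected_induce_attach hrk (K := Set.range Sum.inl) ⟨t₀, ht₀⟩
        (fun t _ => ⟨t, rfl⟩) (fun m hm => ?_) ?_
      · rcases hparbag m y hm with ⟨z, t, h, _⟩ | h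
        · rw [hy] at h; cases h
        · exact Or.inr h
      · rintro _ _ ha hb ⟨t, rfl⟩ ⟨t', rfl⟩
        obtain ⟨v, hv, hyv⟩ := (hinl t y).1 ha
        obtain ⟨v', hv', hyv'⟩ := (hinl t' y).1 hb
        have hvv : v = v' := by
          rw [hyv] at hyv'
          have h := congrArg Fin.val (Tm.root.inj hyv')
          rw [E.pos_val _ (E.le_bound _ v.2.1), E.pos_val _ (E.le_bound _ v'.2.1)] at h
          exact Subtype.ext h
        subst hvv
        exact ((δ₀.connected v).preconnected ⟨t, hv⟩ ⟨t', hv'⟩).map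
          (⟨fun s => ⟨Sum.inl s.1, (hinl s.1 y).2 ⟨v, s.2, hyv⟩⟩,
            fun h => attach_adj_inl.2 h⟩ : δ₀.tree.induce {t | v ∈ δ₀.bag t} →g
              (attach δ₀.tree par).induce {t | y ∈ bag t})
    | null l z t =>
      refine connected_induce_attach hrk
        -- A null stores its label and its whole tuple, hence only one bag creates it, and the core
        -- is at most a single node.
        (K := {a | ∃ m : M, a = Sum.inr m ∧ m.1 = (l, bagStep E.Fr l t)}) ⟨t₀, ht₀⟩
        (fun s hs => ?_) (fun m hm => ?_) ?_
      · obtain ⟨v, _, h⟩ := (hinl s y).1 hs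
        rw [hy] at h
        cases h
      · rcases hparbag m y hm with ⟨z', t', h, hb⟩ | h
        · rw [hy] at h
          injection h with h1 h2 h3
          refine Or.inl ⟨m, rfl, ?_⟩
          rw [h1, h3]
          exact Prod.ext rfl hb
        · exact Or.inr h
      · rintro _ _ ha hb ⟨m, rfl, hm⟩ ⟨m', rfl, hm'⟩
        have : m = m' := Subtype.ext (hm.trans hm'.symm)
        subst this
        exact SimpleGraph.Reachable.refl _
  · rintro (t | m)
    · refine (Subtype.val_injective.encard_image (bag (Sum.inl t))).symm.le.trans ?_
      refine le_trans ?_ ((Set.encard_image_le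
        (fun v : ↥(adom E.atoms \ R) => (Tm.root (E.pos v) : E.Term)) (δ₀.bag t)).trans (hδ₀ t))
      refine Set.encard_le_encard ?_
      rintro _ ⟨y, hy, rfl⟩
      obtain ⟨v, hv, h⟩ := (hinl t y).1 hy
      exact ⟨v, hv, h.symm⟩
    · refine (Subtype.val_injective.encard_image (bag (Sum.inr m))).symm.le.trans ?_
      refine le_trans ?_ ((Set.encard_image_le
        (fun v => m.1.2 (E.pos v)) _).trans (hhead _ m.1.1.1.2))
      refine Set.encard_le_encard ?_
      rintro _ ⟨y, hy, rfl⟩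
      obtain ⟨v, hv, h⟩ := (hinr m y).1 hy
      exact ⟨v, hv, h.symm⟩

end ChaseData

/-! ### From the chase to the approximation -/

/-- If all answers to a query from `CQ_k` over finite models of the constraints are answers to `q`,
then they are answers to the approximation of `q`. -/
theorem UCQ.mem_eval_approx {T : Schema} {n k : ℕ} (hk : 1 ≤ k) {C : Set (TGD T)} (hC : C.Finite)
    (hfg : ∀ σ ∈ C, σ.FrontierGuarded)
    (hhead : ∀ σ ∈ C, (adom σ.head).encard ≤ (k : ℕ∞) + 1) {q : UCQ T n} {p : CQ T n}
    (hp : p.InCQk k)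
    (hpq : ∀ M : Inst T, M.Finite → (∀ σ ∈ C, σ.Sat M) → p.eval M ⊆ q.eval M)
    {D : Inst T} (hD : D.Finite) (hsat : ∀ σ ∈ C, σ.Sat D) :
    p.eval D ⊆ (q.approx k hk).eval D := by
  rintro c ⟨h₀, hh₀, hc⟩
  obtain ⟨B, hB⟩ := ((adom_finite p.finite).union
    (hC.biUnion fun σ _ => adom_finite σ.head_finite)).bddAbove
  let E : ChaseData T :=
    { constraints := C
      atoms := p.atoms
      target := D
      base := h₀
      bound := B
      le_bound := fun v hv => hB (Or.inl hv)
      le_bound_head := fun σ hσ v hv => hB (Or.inr (Set.mem_biUnion hσ hv))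
      isHom := hh₀ }
  -- `N` bounds the number of atoms of the disjuncts of `q`, so that matches of all of them lift.
  obtain ⟨N, hN⟩ := (q.finite.image fun p₀ => p₀.atoms.ncard).bddAbove
  obtain ⟨ρ, hρfin, hρ, hlift⟩ := E.exists_finite_image hC hD N
  let M : Inst T := Atom.map ρ '' E.chase
  have hMfin : M.Finite := (finite_atoms hρfin).subset (by
    rintro _ ⟨α, _, rfl⟩ i
    exact ⟨_, rfl⟩)
  have hMq : (fun i => ρ (Tm.root (E.pos (p.ans i)))) ∈ q.eval M := by
    refine hpq M hMfin (fun σ hσ => E.sat_image hρ hσ (hfg σ hσ) (hsat σ hσ)) ?_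
    refine ⟨fun v => ρ (Tm.root (E.pos v)), fun a ha => ?_, fun i => rfl⟩
    exact ⟨_, ⟨0, none, _, IsBag.root, a, ha, rfl⟩, rfl⟩
  obtain ⟨p₀, hp₀, g, hg, hgans⟩ := Set.mem_iUnion₂.1 hMq
  obtain ⟨g', hg', hgr⟩ := hlift p₀.atoms p₀.finite (hN ⟨p₀, hp₀, rfl⟩) g hg
  have hans : ∀ i, g' (p₀.ans i) = Tm.root (E.pos (p.ans i)) :=
    fun i => hgr _ (p₀.occurs i) _ (hgans i)
  have hposans : ∀ i, (E.pos (p.ans i) : ℕ) = p.ans i :=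
    fun i => E.pos_val _ (E.le_bound _ (p.occurs i))
  obtain ⟨p', hcontr, hhom, hinj⟩ := p₀.exists_contraction_injOn hg' (by
    intro i j h
    simp only [hans] at h
    have h := congrArg Fin.val (Tm.root.inj h)
    rw [hposans, hposans] at h
    exact p.injective h)
  have hans' : p'.ans = p₀.ans := by
    obtain ⟨_, _, _, h, _⟩ := hcontr
    exact h
  refine Set.mem_iUnion₂.2 ⟨p', ⟨⟨p₀, hp₀, hcontr⟩, ?_⟩, E.proj ∘ g', fun a ha => ?_, fun i => ?_⟩
  · by_cases hbot : (gaifman p'.atoms).induce p'.exVars = ⊥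
    · exact Or.inl ⟨hbot, hk⟩
    · obtain ⟨δ, hδ⟩ := E.exists_decomposition (R := Set.range p.ans) hp hhead
      -- By injectivity, existential variables of the contraction avoid the images of the answer
      -- variables, which are exactly the elements left out of the decomposition.
      have hmem : ∀ v ∈ p'.exVars,
          g' v ∈ adom E.chase \ (fun v => Tm.root (E.pos v)) '' Set.range p.ans := by
        rintro v ⟨hv, hvans⟩
        refine ⟨?_, ?_⟩
        · obtain ⟨a, ha, i, rfl⟩ := mem_adom.1 hv
          exact mem_adom.2 ⟨_, hhom a ha, i, rfl⟩
        · rintro ⟨_, ⟨i, rfl⟩, h⟩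
          refine hvans ⟨i, hinj (p'.occurs i) hv ?_⟩
          rw [hans', hans]
          exact h
      refine Or.inr ⟨hbot, δ.exists_comap hδ ⟨fun v => ⟨g' v.1, hmem v.1 v.2⟩, ?_⟩ ?_⟩
      · rintro u v ⟨hne, a, ha, ⟨i, hi⟩, ⟨j, hj⟩⟩
        refine ⟨fun h => hne (hinj u.2.1 v.2.1 h), _, hhom a ha, ⟨i, ?_⟩, ⟨j, ?_⟩⟩
        · exact congrArg g' hi
        · exact congrArg g' hj
      · intro u v h
        exact Subtype.ext (hinj u.2.1 v.2.1 (congrArg Subtype.val h))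
  · exact E.isHom_proj _ (hhom a ha)
  · rw [Function.comp_apply, hans', hans, ← hc i]
    exact congrArg h₀ (hposans i)

end CQSpec

theorem mainTheorem8 (r m k : ℕ) (hr : 1 ≤ r) (hm : 1 ≤ m) (hk : 1 ≤ k) (hkrm : r * m - 1 ≤ k)
    (T : CQSpec.Schema) (hT : T.HasArity r) (n : ℕ) (S : CQSpec.CQS T n)
    (hS : CQSpec.InFG m S.constraints) :
    S.UniformlyUCQkEquivalent k ↔ S.Equivalent (S.approx k hk) := by
  constructor
  · rintro ⟨S', hS', hk', ⟨_, hSS'⟩, ⟨_, hS'S⟩⟩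
    have hhead : ∀ σ ∈ S.constraints, (CQSpec.adom σ.head).encard ≤ (k : ℕ∞) + 1 := by
      intro σ hσ
      refine (CQSpec.encard_adom_le σ.head_finite (fun R => hT.2 ⟨R, rfl⟩) (hS σ hσ).2).trans ?_
      exact_mod_cast (by omega : r * m ≤ k + 1)
    refine ⟨⟨rfl, fun D hD hsat c hc => ?_⟩, rfl, fun D hD hsat c hc => ?_⟩
    · obtain ⟨p, hp, hpc⟩ := Set.mem_iUnion₂.1 (hSS' D hD hsat hc)
      refine CQSpec.UCQ.mem_eval_approx hk S.constraints_finite (fun σ hσ => (hS σ hσ).1) hhead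
        (hk' p hp) (fun M hM hMsat a ha => ?_) hD hsat hpc
      -- The converse containment is needed over every finite model, since it is applied to the
      -- quotient of the chase and not to `D`.
      exact hS'S M hM (hS' ▸ hMsat) (Set.mem_iUnion₂.2 ⟨p, hp, ha⟩)
    · obtain ⟨p, ⟨⟨p₀, hp₀, hcontr⟩, _⟩, hpc⟩ := Set.mem_iUnion₂.1 hc
      exact Set.mem_iUnion₂.2 ⟨p₀, hp₀, hcontr.eval_subset D hpc⟩
  · intro h
    exact ⟨S.approx k hk, rfl, fun p hp => hp.2, h⟩
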